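/- Let $(X,g)$ be a compact Kähler manifold and let $(E,h)\to X$ be a holomorphic vector bundle of finite rank with a smooth Hermitian metric. Let $\nabla$ denote the Chern connection of $(E,h)$, and let $\nabla^2_{V,W}s=\nabla_V\nabla_W s-\nabla_{\nabla_V W}s$ be the second covariant derivative, where $\nabla_V W$ is computed with the Levi-Civita connection of $g$. A holomorphic section $s\in H^0(X,E)$ is called transverse if $\nabla s(x):T_xX\to E_x$ is onto at every $x$ with $s(x)=0$; its zero set $Z(s)=\{s=0\}$ is then a smooth submanifold of $X$, and it is equipped with the restricted metric $g|_{Z(s)}$. Then there exists a constant $C>0$, depending only on $(X,g)$ and $(E,h)$, such that for every transverse $s\in H^0(X,E)$, every $x\in Z(s)$ and every real 2-plane $P\subset T_xZ(s)$, $$|K^{Z(s)}(x,P)-K^X(x,P)|\le C\,\|(\nabla s\,\nabla s^*)^{-1}\|^2\,(\|\nabla^2 s\|+\|\nabla s\|)^2\,\|\nabla s\|^2,$$ where $K^{Z(s)}$ and $K^X$ are the sectional curvatures of $(Z(s),g|_{Z(s)})$ and $(X,g)$, $\nabla s^*:E_x\to T_xX$ is the adjoint of $\nabla s(x)$ with respect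 to $g$ and $h$, the norms are the operator norms with respect to $g$ and $h$, and the right-hand side is evaluated at $x$. -/

import Mathlib

open scoped Manifold ContDiff Topology

noncomputable section

set_option maxSynthPendingDepth 3

namespace KahlerCurv

/-! ### Riemannian metrics in coordinates

`G u v w` is the value at the point `u` of a (pseudo-)metric on an open subset of the vector
space `W`, applied to the vectors `v` and `w`. -/

section Coordinates

variable {W : Type*} [NormedAddCommGroup W] [NormedSpace ℝ W]

/-- The Christoffel symbols of the first kind,
`[v w, z] = (D_v G(w, z) + D_w G(v, z) - D_z G(v, w)) / 2`, at the point `u`. -/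
def koszul (G : W → W →L[ℝ] W →L[ℝ] ℝ) (u : W) : W →L[ℝ] W →L[ℝ] W →L[ℝ] ℝ :=
  let D : W →L[ℝ] W →L[ℝ] W →L[ℝ] ℝ := fderiv ℝ G u
  let D' : W →L[ℝ] W →L[ℝ] W →L[ℝ] ℝ :=
    (ContinuousLinearMap.flipₗᵢ ℝ W W ℝ).toContinuousLinearEquiv.toContinuousLinearMap ∘L D.flip
  (1 / 2 : ℝ) • (D + D.flip - D')

theorem koszul_apply (G : W → W →L[ℝ] W →L[ℝ] ℝ) (u v w z : W) :
    koszul G u v w z =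
      (1 / 2) * (fderiv ℝ G u v w z + fderiv ℝ G u w v z - fderiv ℝ G u z v w) := rfl

/-- The Christoffel symbols (of the second kind) `Γ(v, w)` of the Levi-Civita connection of `G` at
the point `u`: the vector with `G(Γ(v, w), z) = [v w, z]` for all `z`. For constant vector fields
`v` and `w`, `∇_v w = Γ(v, w)`. -/
def christoffel (G : W → W →L[ℝ] W →L[ℝ] ℝ) (u : W) : W →L[ℝ] W →L[ℝ] W :=
  (ContinuousLinearMap.compL ℝ W (W →L[ℝ] ℝ) W (G u).inverse) ∘L koszul G u

theorem christoffel_spec (G : W → W →L[ℝ] W →L[ℝ] ℝ) (u : W) (hG : (G u).IsInvertible)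
    (v w z : W) : G u (christoffel G u v w) z = koszul G u v w z := by
  have h : G u ((G u).inverse (koszul G u v w)) = koszul G u v w :=
    hG.self_apply_inverse _
  exact congrArg (fun l : W →L[ℝ] ℝ => l z) h

/-- The Riemann curvature tensor `R(v, w) z = ∇_v ∇_w z - ∇_w ∇_v z - ∇_[v, w] z` of `G` at the
point `u`, computed with constant vector fields. -/
def riemann (G : W → W →L[ℝ] W →L[ℝ] ℝ) (u v w z : W) : W :=
  fderiv ℝ (fun u' => christoffel G u' w z) u v - fderiv ℝ (fun u' => christoffel G u' v z) u w
    + christoffel G u v (christoffel G u w z) - christoffel G u w (christoffel G u v z)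

/-- The sectional curvature `⟨R(v, w) w, v⟩` of `G` at the point `u` on the plane with orthonormal
basis `v, w` (and, thanks to the denominator, on the plane spanned by any two independent
vectors). -/
def secCurv (G : W → W →L[ℝ] W →L[ℝ] ℝ) (u v w : W) : ℝ :=
  G u (riemann G u v w w) v / (G u v v * G u w w - G u v w ^ 2)

end Coordinates

/-! ### Complex manifolds with a Riemannian metric -/

section Manifold

variable {EX : Type*} [NormedAddCommGroup EX] [NormedSpace ℂ EX]
  {X : Type*} [TopologicalSpace X] [ChartedSpace EX X]

/-- A complex manifold is a smooth real manifold. -/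
instance realManifold [IsManifold 𝓘(ℂ, EX) ω X] : IsManifold 𝓘(ℝ, EX) ∞ X := by
  refine isManifold_of_contDiffOn _ _ _ fun e e' he he' => ?_
  have h := (contDiffGroupoid ω 𝓘(ℂ, EX)).compatible he he'
  rw [contDiffGroupoid, mem_groupoid_of_pregroupoid] at h
  have h1 := h.1
  simp only [contDiffPregroupoid] at h1
  exact ((ContDiffOn.restrict_scalars ℝ h1).of_le le_top)

variable (EX X) in
/-- Smooth Riemannian metrics on the manifold `X`: smooth families of real scalar products
`g.inner x` on the tangent spaces `T_x X`. -/
abbrev Metric [IsManifold 𝓘(ℝ, EX) ∞ X] : Type _ :=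
  Bundle.ContMDiffRiemannianMetric 𝓘(ℝ, EX) ∞ EX (fun x : X => TangentSpace 𝓘(ℝ, EX) x)

variable [IsManifold 𝓘(ℝ, EX) ∞ X] (g : Metric EX X)

/-- The pull-back `ψ^* g` of the Riemannian metric `g` of `X` by a map `ψ` from a vector space `W`
to `X`: `(ψ^* g)(v, w) = g(dψ(v), dψ(w))`. -/
def pullbackMetric {W : Type*} [NormedAddCommGroup W] [NormedSpace ℝ W] (ψ : W → X) (u : W) :
    W →L[ℝ] W →L[ℝ] ℝ :=
  let D : W →L[ℝ] TangentSpace 𝓘(ℝ, EX) (ψ u) := mfderiv 𝓘(ℝ, W) 𝓘(ℝ, EX) ψ u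
  (D.precomp ℝ) ∘L g.inner (ψ u) ∘L D

theorem pullbackMetric_apply {W : Type*} [NormedAddCommGroup W] [NormedSpace ℝ W] (ψ : W → X)
    (u v w : W) : pullbackMetric g ψ u v w =
      g.inner (ψ u) (mfderiv 𝓘(ℝ, W) 𝓘(ℝ, EX) ψ u v) (mfderiv 𝓘(ℝ, W) 𝓘(ℝ, EX) ψ u w) := rfl

/-- The Riemannian metric of `X` written in the preferred chart of `X` around `x`. -/
def chartMetric (x : X) : EX → EX →L[ℝ] EX →L[ℝ] ℝ :=
  pullbackMetric g (extChartAt 𝓘(ℝ, EX) x).symm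

/-- The derivative at `x` of the preferred chart of `X` around `x`. -/
def chartDeriv (x : X) : TangentSpace 𝓘(ℝ, EX) x →L[ℝ] EX :=
  mfderiv 𝓘(ℝ, EX) 𝓘(ℝ, EX) (extChartAt 𝓘(ℝ, EX) x) x

/-- The sectional curvature of `X` at `x` on the real plane with basis `V, W`. -/
def sectionalCurvature (x : X) (V W : TangentSpace 𝓘(ℝ, EX) x) : ℝ :=
  secCurv (chartMetric g x) (extChartAt 𝓘(ℝ, EX) x x) (chartDeriv x V) (chartDeriv x W)

/-- The Riemannian metric `g` of the complex manifold `X` is Kähler: it is invariant under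
multiplication by `i`, and the 2-form `ω(b, c) = g(i b, c)` is closed. Both conditions are read at
every point in the (holomorphic) preferred chart around this point. -/
structure IsKahler : Prop where
  invariant : ∀ (x : X) (a b : EX),
    chartMetric g x (extChartAt 𝓘(ℝ, EX) x x) (Complex.I • a) (Complex.I • b) =
      chartMetric g x (extChartAt 𝓘(ℝ, EX) x x) a b
  closed : ∀ (x : X) (a b c : EX),
    fderiv ℝ (chartMetric g x) (extChartAt 𝓘(ℝ, EX) x x) a (Complex.I • b) c
      + fderiv ℝ (chartMetric g x) (extChartAt 𝓘(ℝ, EX) x x) b (Complex.I • c) a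
      + fderiv ℝ (chartMetric g x) (extChartAt 𝓘(ℝ, EX) x x) c (Complex.I • a) b = 0


end Manifold

/-! ### Submanifolds -/

section Submanifold

variable {EX : Type*} [NormedAddCommGroup EX] [NormedSpace ℂ EX]
  {X : Type*} [TopologicalSpace X] [ChartedSpace EX X]

/-- `ψ` is a smooth local parametrization of the subset `S` of the real manifold `X` around the
point `ψ 0`: it is an immersion at `0`, and it maps the neighbourhoods of `0` onto the
neighbourhoods of `ψ 0` in `S` (in particular `ψ` takes values in `S` near `0`). -/
structure IsLocalParametrization (S : Set X) {m : ℕ} (ψ : EuclideanSpace ℝ (Fin m) → X) :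
    Prop where
  smooth : ContMDiffAt 𝓘(ℝ, EuclideanSpace ℝ (Fin m)) 𝓘(ℝ, EX) ∞ ψ 0
  immersion : Function.Injective (mfderiv 𝓘(ℝ, EuclideanSpace ℝ (Fin m)) 𝓘(ℝ, EX) ψ 0)
  map_nhds : Filter.map ψ (𝓝 0) = 𝓝[S] (ψ 0)

/-- `HasSectionalCurvature g S x V W K` says that `V` and `W` are tangent at `x` to `S`, seen as a
submanifold of `X`, and that `K` is the sectional curvature at `x`, on the real plane with basis
`V, W`, of `S` equipped with the restriction of the Riemannian metric `g` of `X`; the curvature is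
computed in a local parametrization `ψ` of `S` around `x = ψ 0` with `V = dψ(a)`, `W = dψ(b)`. -/
inductive HasSectionalCurvature [IsManifold 𝓘(ℝ, EX) ∞ X] (g : Metric EX X)
    (S : Set X) : (x : X) → TangentSpace 𝓘(ℝ, EX) x → TangentSpace 𝓘(ℝ, EX) x → ℝ → Prop
  | intro {m : ℕ} (ψ : EuclideanSpace ℝ (Fin m) → X) (hψ : IsLocalParametrization (EX := EX) S ψ)
      (a b : EuclideanSpace ℝ (Fin m)) :
      HasSectionalCurvature g S (ψ 0)
        (mfderiv 𝓘(ℝ, EuclideanSpace ℝ (Fin m)) 𝓘(ℝ, EX) ψ 0 a)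
        (mfderiv 𝓘(ℝ, EuclideanSpace ℝ (Fin m)) 𝓘(ℝ, EX) ψ 0 b)
        (secCurv (pullbackMetric g ψ) 0 a b)

end Submanifold

/-! ### Hermitian holomorphic bundles and the Chern connection -/

section Bundle

/-- The real scalar product `(v, w) ↦ Re ⟨v, w⟩` of a Hermitian space. -/
def realPairing (V : Type*) [NormedAddCommGroup V] [InnerProductSpace ℂ V] :
    V →L[ℝ] V →L[ℝ] ℝ :=
  letI : InnerProductSpace ℝ V := InnerProductSpace.rclikeToReal ℂ V
  innerSL ℝ

theorem realPairing_apply {V : Type*} [NormedAddCommGroup V] [InnerProductSpace ℂ V] (v w : V) :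
    realPairing V v w = (inner ℂ v w).re := rfl

variable {EX : Type*} [NormedAddCommGroup EX] [NormedSpace ℂ EX]
  {X : Type*} [TopologicalSpace X] [ChartedSpace EX X]
  (F : Type*) [NormedAddCommGroup F] [NormedSpace ℂ F]
  (E : X → Type*) [TopologicalSpace (Bundle.TotalSpace F E)]
  [∀ x, NormedAddCommGroup (E x)] [∀ x, InnerProductSpace ℂ (E x)]
  [FiberBundle F E] [VectorBundle ℂ F E]

/-- The Hermitian metric of `E` in the holomorphic trivialization of `E` around `x₀`, at the point
`y`: the form `(v, w) ↦ h(v, w)` on `F`, linear in `v` and conjugate linear in `w`. -/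
def gram (x₀ y : X) : F →L[ℂ] F →L⋆[ℂ] ℂ :=
  let e := trivializationAt F E x₀
  (innerSLFlip ℂ : E y →L[ℂ] E y →L⋆[ℂ] ℂ).bilinearComp (e.symmL ℂ y) (e.symmL ℂ y)

variable (EX) in
/-- The Hermitian metric of `E` is smooth (in the real sense). -/
def IsSmoothHermitian : Prop :=
  ∀ x₀ : X, ContMDiffOn 𝓘(ℝ, EX) 𝓘(ℝ, F →L[ℂ] F →L⋆[ℂ] ℂ) ∞ (gram F E x₀)
    (trivializationAt F E x₀).baseSet

/-- The Hermitian metric of `E` in the chart and the trivialization around `x₀`. -/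
def gramLoc (x₀ : X) (u : EX) : F →L[ℂ] F →L⋆[ℂ] ℂ :=
  gram F E x₀ ((extChartAt 𝓘(ℝ, EX) x₀).symm u)

/-- `∂H(V) = (D_V H - i D_{iV} H) / 2`, where `H` is the Hermitian metric in the chart and the
trivialization around `x₀`. -/
def delGram (x₀ : X) (u : EX) : EX →L[ℝ] F →L[ℂ] F →L⋆[ℂ] ℂ :=
  let D : EX →L[ℝ] F →L[ℂ] F →L⋆[ℂ] ℂ := fderiv ℝ (gramLoc F E x₀) u
  let J : EX →L[ℝ] EX := (Complex.I • ContinuousLinearMap.id ℂ EX).restrictScalars ℝ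
  (1 / 2 : ℝ) • (D - Complex.I • (D ∘L J))

theorem delGram_apply (x₀ : X) (u V : EX) (v w : F) :
    delGram F E x₀ u V v w = (1 / 2 : ℝ) • (fderiv ℝ (gramLoc F E x₀) u V v w -
      Complex.I • fderiv ℝ (gramLoc F E x₀) u (Complex.I • V) v w) := rfl

/-- The connection form `A = H⁻¹ ∂H` of the Chern connection of `(E, h)`, in the chart and the
trivialization around `x₀`. -/
def chernForm (x₀ : X) (u : EX) : EX →L[ℝ] F →L[ℂ] F :=
  ((ContinuousLinearMap.compL ℂ F (F →L⋆[ℂ] ℂ) F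
    (gramLoc F E x₀ u).inverse).restrictScalars ℝ) ∘L delGram F E x₀ u

variable {E}

/-- The section `s` in the chart and the trivialization around `x₀`. -/
def secLoc (s : ∀ x, E x) (x₀ : X) (u : EX) : F :=
  (trivializationAt F E x₀ ⟨(extChartAt 𝓘(ℝ, EX) x₀).symm u,
    s ((extChartAt 𝓘(ℝ, EX) x₀).symm u)⟩).2

/-- The Chern covariant derivative `V ↦ ∇_V s = D_V s + A(V) s`, in the chart and the
trivialization around `x₀`. -/
def covLoc (s : ∀ x, E x) (x₀ : X) (u : EX) : EX →L[ℝ] F :=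
  fderiv ℝ (secLoc F s x₀) u +
    ((ContinuousLinearMap.apply ℂ F (secLoc F s x₀ u)).restrictScalars ℝ) ∘L chernForm F E x₀ u

theorem covLoc_apply (s : ∀ x, E x) (x₀ : X) (u V : EX) :
    covLoc F s x₀ u V =
      fderiv ℝ (secLoc F s x₀) u V + chernForm F E x₀ u V (secLoc F s x₀ u) := rfl

/-- The Chern covariant derivative `∇ s (x) : T_x X → E_x`. -/
def nabla (s : ∀ x, E x) (x : X) : TangentSpace 𝓘(ℝ, EX) x →L[ℝ] E x :=
  (((trivializationAt F E x).symmL ℂ x).restrictScalars ℝ) ∘L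
    covLoc F s x (extChartAt 𝓘(ℝ, EX) x x) ∘L chartDeriv x

variable [IsManifold 𝓘(ℝ, EX) ∞ X] (g : Metric EX X)

/-- The operator norm of `∇ s (x)`, for the metric `g` on `T_x X` and the metric of `E_x`. -/
def normNabla (s : ∀ x, E x) (x : X) : ℝ :=
  sSup {t | ∃ V : TangentSpace 𝓘(ℝ, EX) x, g.inner x V V ≤ 1 ∧ t = ‖nabla F s x V‖}

/-- The adjoint `(∇s)^* : E_x → T_x X` of `∇ s (x)` for the metrics of `T_x X` and `E_x`: the
composition of `e ↦ (V ↦ Re ⟨e, ∇_V s⟩)`, with values in the cotangent space, and of the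
identification `T_x^* X → T_x X` given by `g`. -/
def nablaStar (s : ∀ x, E x) (x : X) : E x →L[ℝ] TangentSpace 𝓘(ℝ, EX) x :=
  (g.inner x).inverse ∘L ((nabla F s x).precomp ℝ) ∘L realPairing (E x)

theorem nablaStar_spec (s : ∀ x, E x) (x : X) (hg : (g.inner x).IsInvertible) (e : E x)
    (V : TangentSpace 𝓘(ℝ, EX) x) :
    g.inner x (nablaStar F g s x e) V = (inner ℂ e (nabla F s x V)).re := by
  have h := hg.self_apply_inverse (((nabla F s x).precomp ℝ) (realPairing (E x) e))
  exact congrArg (fun l : TangentSpace 𝓘(ℝ, EX) x →L[ℝ] ℝ => l V) h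

/-- The second covariant derivative `(V, W) ↦ ∇_V ∇_W s - ∇_{∇_V W} s`, where `∇` is the Chern
connection of `E` and the Levi-Civita connection of `g`, in the chart and the trivialization
around `x₀`. -/
def hessLoc (s : ∀ x, E x) (x₀ : X) (u : EX) : EX →L[ℝ] EX →L[ℝ] F :=
  fderiv ℝ (covLoc F s x₀) u
    + (ContinuousLinearMap.compL ℝ EX F F).flip (covLoc F s x₀ u) ∘L
        (ContinuousLinearMap.restrictScalarsL ℂ F F ℝ ℝ) ∘L chernForm F E x₀ u
    - (ContinuousLinearMap.compL ℝ EX EX F (covLoc F s x₀ u)) ∘L christoffel (chartMetric g x₀) u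

theorem hessLoc_apply (s : ∀ x, E x) (x₀ : X) (u V W : EX) :
    hessLoc F g s x₀ u V W =
      fderiv ℝ (covLoc F s x₀) u V W + chernForm F E x₀ u V (covLoc F s x₀ u W)
        - covLoc F s x₀ u (christoffel (chartMetric g x₀) u V W) := rfl

/-- The second covariant derivative `∇² s (x)(V, W) ∈ E_x` of `s` at `x`, for `V, W ∈ T_x X`. -/
def nabla2 (s : ∀ x, E x) (x : X) (V W : TangentSpace 𝓘(ℝ, EX) x) : E x :=
  (trivializationAt F E x).symmL ℂ x
    (hessLoc F g s x (extChartAt 𝓘(ℝ, EX) x x) (chartDeriv x V) (chartDeriv x W))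

/-- The norm of the bilinear map `∇² s (x)`, for the metric `g` on `T_x X` and the metric of
`E_x`. -/
def normNabla2 (s : ∀ x, E x) (x : X) : ℝ :=
  sSup {t | ∃ V W : TangentSpace 𝓘(ℝ, EX) x, g.inner x V V ≤ 1 ∧ g.inner x W W ≤ 1 ∧
    t = ‖nabla2 F g s x V W‖}

variable (EX) in
/-- A section is transverse (to the zero section) if `∇ s (x) : T_x X → E_x` is onto at every zero
`x` of `s`. -/
def IsTransverse (s : ∀ x, E x) : Prop :=
  ∀ x, s x = 0 → Function.Surjective (nabla (EX := EX) F s x)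

end Bundle

end KahlerCurv

end

set_option maxSynthPendingDepth 3

/-! The argument is the Gauss equation together with a bound on the second fundamental form `B` of
`Z(s)`. For orthonormal tangent vectors `a, b`, `K^Z - K^X = ⟨B(a,a), B(b,b)⟩ - |B(a,b)|²`, so `|B|
≤ M` on unit vectors gives the bound `2 M²`.

To bound `B`, put `L = ∇s(x)`. Differentiating `s = 0` twice along `Z(s)` gives `L B(a,b) =
-∇²s(a,b)`: at a zero of `s` the connection form contributes nothing to `∇s`, nor to `∇²s` on
vectors of `ker L`. Since `B` is orthogonal to `T_xZ(s) = ker L` and `L` is onto, `B = L^*(L L^*)⁻¹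
L B`. Hence `M = ‖∇s‖ ‖(∇s ∇s^*)⁻¹‖ ‖∇²s‖` works, and the theorem holds with `C = 2`.

Everything is computed in the preferred chart and trivialization at `x`, with `Z(s)` replaced by a
parametrization `f` into a vector space. The main lemmas are `gauss_equation`,
`secondForm_orthogonal`, `sqrt_le_of_orthogonal_ker`, `hessLoc_of_eq_zero` and, for `T_xZ(s) ⊇ ker
L`, `range_fderiv_subset_of_parametrization`; `abs_secCurv_sub_le` assembles them. -/

namespace KahlerCurv

/-! ### Levi-Civita calculus in coordinates and the Gauss equation. -/

section Gauss

variable {V W : Type*} [NormedAddCommGroup V] [NormedSpace ℝ V] [NormedAddCommGroup W]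
  [NormedSpace ℝ W]

/-- `G` is a twice continuously differentiable pseudo-Riemannian metric near `p`. -/
structure IsMetricAt (G : V → V →L[ℝ] V →L[ℝ] ℝ) (p : V) : Prop where
  contDiffAt : ContDiffAt ℝ 2 G p
  symm : ∀ᶠ u in 𝓝 p, ∀ v w, G u v w = G u w v
  isInvertible : (G p).IsInvertible

theorem IsMetricAt.differentiableAt {G : V → V →L[ℝ] V →L[ℝ] ℝ} {p : V} (h : IsMetricAt G p) :
    DifferentiableAt ℝ G p := h.contDiffAt.differentiableAt (by norm_num)

/-- All three conditions are open. This allows pointwise identities between Christoffel symbols to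
be differentiated. -/
theorem IsMetricAt.eventually [CompleteSpace V] {G : V → V →L[ℝ] V →L[ℝ] ℝ} {p : V}
    (h : IsMetricAt G p) : ∀ᶠ u in 𝓝 p, IsMetricAt G u := by
  have hi : ∀ᶠ u in 𝓝 p, (G u).IsInvertible := by
    obtain ⟨e, he⟩ := h.isInvertible
    have := e.nhds
    rw [he] at this
    exact h.contDiffAt.continuousAt.eventually this
  filter_upwards [h.contDiffAt.eventually (by simp), h.symm.eventually_nhds, hi] with u h1 h2 h3
  exact ⟨h1, h2, h3⟩

theorem fderiv_apply_apply {G : V → V →L[ℝ] V →L[ℝ] ℝ} {p : V} (h : DifferentiableAt ℝ G p)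
    (v w z : V) : fderiv ℝ (fun u => G u w z) p v = fderiv ℝ G p v w z := by
  have h1 : HasFDerivAt (fun u => G u w z) _ p :=
    (h.hasFDerivAt.clm_apply (hasFDerivAt_const w p)).clm_apply (hasFDerivAt_const z p)
  rw [h1.fderiv]
  simp

theorem IsMetricAt.fderiv_symm {G : V → V →L[ℝ] V →L[ℝ] ℝ} {p : V} (h : IsMetricAt G p)
    (v w z : V) : fderiv ℝ G p v w z = fderiv ℝ G p v z w := by
  rw [← fderiv_apply_apply h.differentiableAt, ← fderiv_apply_apply h.differentiableAt]
  congr 1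
  apply Filter.EventuallyEq.fderiv_eq
  filter_upwards [h.symm] with u hu using hu w z

theorem IsMetricAt.koszul_symm {G : V → V →L[ℝ] V →L[ℝ] ℝ} {p : V} (h : IsMetricAt G p)
    (v w z : V) : koszul G p v w z = koszul G p w v z := by
  rw [koszul_apply, koszul_apply, h.fderiv_symm z v w]
  ring

theorem IsMetricAt.christoffel_symm {G : V → V →L[ℝ] V →L[ℝ] ℝ} {p : V} (h : IsMetricAt G p)
    (v w : V) : christoffel G p v w = christoffel G p w v := by
  obtain ⟨e, he⟩ := h.isInvertible
  apply e.injective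
  have : (e : V → V →L[ℝ] ℝ) = G p := by rw [← he]; rfl
  rw [this]
  ext z
  rw [christoffel_spec _ _ h.isInvertible, christoffel_spec _ _ h.isInvertible, h.koszul_symm]

/-- Metric compatibility of the Levi-Civita connection on constant fields: in the sum of the two
Koszul expressions all other derivatives of `G` cancel. -/
theorem IsMetricAt.fderiv_eq {G : V → V →L[ℝ] V →L[ℝ] ℝ} {p : V} (h : IsMetricAt G p)
    (v w z : V) : fderiv ℝ G p v w z
      = G p (christoffel G p v w) z + G p w (christoffel G p v z) := by
  rw [h.symm.self_of_nhds w, christoffel_spec _ _ h.isInvertible,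
    christoffel_spec _ _ h.isInvertible, koszul_apply, koszul_apply, h.fderiv_symm v z w]
  ring

theorem contDiffAt_koszul {G : V → V →L[ℝ] V →L[ℝ] ℝ} {p : V} (h : ContDiffAt ℝ 2 G p) :
    ContDiffAt ℝ 1 (koszul G) p := by
  have hD : ContDiffAt ℝ 1 (fderiv ℝ G) p := h.fderiv_right (by norm_num)
  have hf : ContDiffAt ℝ 1 (fun u => (fderiv ℝ G u).flip) p :=
    (ContinuousLinearMap.flipₗᵢ ℝ V V (V →L[ℝ] ℝ)).toContinuousLinearEquiv.contDiff.contDiffAt.comp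
      p hD
  unfold koszul
  have hs : ContDiffAt ℝ 1 (fun u => fderiv ℝ G u + (fderiv ℝ G u).flip -
      (ContinuousLinearMap.flipₗᵢ ℝ V V ℝ).toContinuousLinearEquiv.toContinuousLinearMap ∘L
        (fderiv ℝ G u).flip) p :=
    (hD.add hf).sub (contDiffAt_const.clm_comp hf)
  exact hs.const_smul (1 / 2 : ℝ)

theorem IsMetricAt.contDiffAt_christoffel [CompleteSpace V] {G : V → V →L[ℝ] V →L[ℝ] ℝ} {p : V}
    (h : IsMetricAt G p) : ContDiffAt ℝ 1 (christoffel G) p := by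
  obtain ⟨e, he⟩ := h.isInvertible
  have h1 : ContDiffAt ℝ 1 (fun u => (G u).inverse) p := by
    have := contDiffAt_map_inverse (n := 1) e
    rw [he] at this
    exact this.comp p (h.contDiffAt.of_le (by norm_num))
  have h2 : ContDiffAt ℝ 1
      (fun u => ContinuousLinearMap.compL ℝ V (V →L[ℝ] ℝ) V (G u).inverse) p :=
    (ContinuousLinearMap.contDiff _).contDiffAt.comp p h1
  exact h2.clm_comp (contDiffAt_koszul h.contDiffAt)

theorem IsMetricAt.differentiableAt_christoffel [CompleteSpace V] {G : V → V →L[ℝ] V →L[ℝ] ℝ}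
    {p : V} (h : IsMetricAt G p) : DifferentiableAt ℝ (christoffel G) p :=
  h.contDiffAt_christoffel.differentiableAt (by norm_num)

/-- Compatibility of the Levi-Civita connection with the metric, along the map `f`. -/
theorem IsMetricAt.fderiv_along {G : V → V →L[ℝ] V →L[ℝ] ℝ} {f : W → V} {p : W}
    (h : IsMetricAt G (f p)) (hf : DifferentiableAt ℝ f p) {Y Z : W → V}
    (hY : DifferentiableAt ℝ Y p) (hZ : DifferentiableAt ℝ Z p) (a : W) :
    fderiv ℝ (fun u => G (f u) (Y u) (Z u)) p a =
      G (f p) (fderiv ℝ Y p a + christoffel G (f p) (fderiv ℝ f p a) (Y p)) (Z p)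
        + G (f p) (Y p) (fderiv ℝ Z p a + christoffel G (f p) (fderiv ℝ f p a) (Z p)) := by
  have h1 : HasFDerivAt (fun u => G (f u)) _ p :=
    HasFDerivAt.comp (g := G) p h.differentiableAt.hasFDerivAt hf.hasFDerivAt
  have h2 : HasFDerivAt (fun u => G (f u) (Y u) (Z u)) _ p :=
    (h1.clm_apply hY.hasFDerivAt).clm_apply hZ.hasFDerivAt
  rw [h2.fderiv]
  simp only [add_apply, ContinuousLinearMap.comp_apply,
    ContinuousLinearMap.flip_apply, h.fderiv_eq, map_add]
  ring

/-- The curvature tensor in terms of the Christoffel symbols of the first kind. -/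
theorem IsMetricAt.riemann_apply [CompleteSpace V] {G : V → V →L[ℝ] V →L[ℝ] ℝ} {p : V}
    (h : IsMetricAt G p) (v w z x : V) :
    G p (riemann G p v w z) x =
      fderiv ℝ (fun u => koszul G u w z x) p v - fderiv ℝ (fun u => koszul G u v z x) p w
        - G p (christoffel G p w z) (christoffel G p v x)
        + G p (christoffel G p v z) (christoffel G p w x) := by
  -- Differentiates `koszul G u w z x = G u (christoffel G u w z) x` with the constant field `x`;
  -- curvature is the part antisymmetric in `v, w`.
  have key : ∀ v w : V, fderiv ℝ (fun u => koszul G u w z x) p v =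
      G p (fderiv ℝ (fun u => christoffel G u w z) p v + christoffel G p v (christoffel G p w z)) x
        + G p (christoffel G p w z) (christoffel G p v x) := by
    intro v w
    have hd : DifferentiableAt ℝ (fun u => christoffel G u w z) p :=
      (h.differentiableAt_christoffel.clm_apply (differentiableAt_const w)).clm_apply
        (differentiableAt_const z)
    have h1 := IsMetricAt.fderiv_along (f := id) (p := p) h differentiableAt_id hd
      (differentiableAt_const x) v
    simp only [fderiv_id, id, ContinuousLinearMap.id_apply, fderiv_fun_const] at h1
    rw [show (0 : V → V →L[ℝ] V) p v = 0 from rfl, zero_add] at h1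
    rw [← h1]
    congr 1
    apply Filter.EventuallyEq.fderiv_eq
    filter_upwards [h.eventually] with u hu
    exact (christoffel_spec G u hu.isInvertible w z x).symm
  rw [key v w, key w v, riemann]
  simp only [map_add, map_sub, add_apply, sub_apply]
  ring

/-- The second fundamental form of the map `f` from `(W, N)` to `(V, G)`. -/
noncomputable def secondForm (G : V → V →L[ℝ] V →L[ℝ] ℝ) (f : W → V) (N : W → W →L[ℝ] W →L[ℝ] ℝ)
    (p a b : W) : V :=
  fderiv ℝ (fderiv ℝ f) p a b + christoffel G (f p) (fderiv ℝ f p a) (fderiv ℝ f p b)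
    - fderiv ℝ f p (christoffel N p a b)

theorem differentiableAt_fderiv_of_contDiffAt {f : W → V} {p : W} (hf : ContDiffAt ℝ 2 f p) :
    DifferentiableAt ℝ (fderiv ℝ f) p :=
  (hf.fderiv_right (m := 1) (by norm_num)).differentiableAt (by norm_num)

theorem snd_fderiv_symm_of_contDiffAt {f : W → V} {p : W} (hf : ContDiffAt ℝ 2 f p) (a b : W) :
    fderiv ℝ (fderiv ℝ f) p a b = fderiv ℝ (fderiv ℝ f) p b a :=
  hf.isSymmSndFDerivAt (by simp) a b

theorem fderiv_fderiv_apply {f : W → V} {p : W} (hf : ContDiffAt ℝ 2 f p) (a b : W) :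
    fderiv ℝ (fun u => fderiv ℝ f u b) p a = fderiv ℝ (fderiv ℝ f) p a b := by
  have h1 : HasFDerivAt (fun u => fderiv ℝ f u b) _ p :=
    (differentiableAt_fderiv_of_contDiffAt hf).hasFDerivAt.clm_apply (hasFDerivAt_const b p)
  rw [h1.fderiv]
  simp

/-- The Christoffel symbols of a pull-back metric. -/
theorem koszul_pullback {G : V → V →L[ℝ] V →L[ℝ] ℝ} {f : W → V} {p : W}
    {N : W → W →L[ℝ] W →L[ℝ] ℝ} (h : IsMetricAt G (f p)) (hN : DifferentiableAt ℝ N p)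
    (hf : ContDiffAt ℝ 2 f p)
    (hNf : ∀ᶠ u in 𝓝 p, ∀ a b, N u a b = G (f u) (fderiv ℝ f u a) (fderiv ℝ f u b)) (a b c : W) :
    koszul N p a b c = G (f p) (fderiv ℝ (fderiv ℝ f) p a b
      + christoffel G (f p) (fderiv ℝ f p a) (fderiv ℝ f p b)) (fderiv ℝ f p c) := by
  have hfd : ∀ b, DifferentiableAt ℝ (fun u => fderiv ℝ f u b) p := fun b =>
    (differentiableAt_fderiv_of_contDiffAt hf).clm_apply (differentiableAt_const b)
  -- Metric compatibility along `f`, applied to the fields `df(b)` and `df(c)`.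
  have key : ∀ a b c : W, fderiv ℝ N p a b c =
      G (f p) (fderiv ℝ (fderiv ℝ f) p a b
        + christoffel G (f p) (fderiv ℝ f p a) (fderiv ℝ f p b)) (fderiv ℝ f p c)
      + G (f p) (fderiv ℝ f p b) (fderiv ℝ (fderiv ℝ f) p a c
        + christoffel G (f p) (fderiv ℝ f p a) (fderiv ℝ f p c)) := by
    intro a b c
    rw [← fderiv_apply_apply hN, ← fderiv_fderiv_apply hf, ← fderiv_fderiv_apply hf,
      ← h.fderiv_along (hf.differentiableAt (by norm_num)) (hfd b) (hfd c)]
    congr 1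
    apply Filter.EventuallyEq.fderiv_eq
    filter_upwards [hNf] with u hu using hu b c
  have hs : ∀ v w, G (f p) v w = G (f p) w v := h.symm.self_of_nhds
  -- Torsion-freeness along `f`; with it the Koszul combination collapses to a single term.
  have hq : ∀ a b : W, fderiv ℝ (fderiv ℝ f) p a b
        + christoffel G (f p) (fderiv ℝ f p a) (fderiv ℝ f p b) =
      fderiv ℝ (fderiv ℝ f) p b a
        + christoffel G (f p) (fderiv ℝ f p b) (fderiv ℝ f p a) := fun a b => by
    rw [snd_fderiv_symm_of_contDiffAt hf, h.christoffel_symm]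
  rw [koszul_apply, key, key, key, hq b a, hq c a, hq c b, hs (fderiv ℝ f p b), hs (fderiv ℝ f p a)]
  ring

/-- The pull-back involves `df`, so one derivative is lost: `f` of class C³ gives a metric of class
C². -/
theorem IsMetricAt.of_pullback {G : V → V →L[ℝ] V →L[ℝ] ℝ} {f : W → V} {p : W}
    {N : W → W →L[ℝ] W →L[ℝ] ℝ} (h : IsMetricAt G (f p)) (hf : ContDiffAt ℝ 3 f p)
    (hN : (N p).IsInvertible)
    (hNf : ∀ᶠ u in 𝓝 p, ∀ a b, N u a b = G (f u) (fderiv ℝ f u a) (fderiv ℝ f u b)) :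
    IsMetricAt N p := by
  refine ⟨?_, ?_, hN⟩
  · have hd : ContDiffAt ℝ 2 (fderiv ℝ f) p := hf.fderiv_right (by norm_num)
    have hGf : ContDiffAt ℝ 2 (fun u => G (f u)) p :=
      ContDiffAt.comp (g := G) p h.contDiffAt (hf.of_le (by norm_num))
    have hpre : ContDiffAt ℝ 2
        (fun u => (ContinuousLinearMap.compL ℝ W V ℝ).flip (fderiv ℝ f u)) p :=
      (ContinuousLinearMap.contDiff _).contDiffAt.comp p hd
    refine (hpre.clm_comp (hGf.clm_comp hd)).congr_of_eventuallyEq ?_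
    filter_upwards [hNf] with u hu
    ext a b
    exact hu a b
  · filter_upwards [hNf, (hf.continuousAt).eventually h.symm] with u hu hs a b
    rw [hu, hu, hs]

/-- By `koszul_pullback`, the covariant derivative of `df(b)` along `df(a)` and the vector
`df(christoffel N p a b)` have the same products with tangent vectors. -/
theorem secondForm_orthogonal {G : V → V →L[ℝ] V →L[ℝ] ℝ} {f : W → V} {p : W}
    {N : W → W →L[ℝ] W →L[ℝ] ℝ} (h : IsMetricAt G (f p)) (hN : IsMetricAt N p)
    (hf : ContDiffAt ℝ 2 f p)
    (hNf : ∀ᶠ u in 𝓝 p, ∀ a b, N u a b = G (f u) (fderiv ℝ f u a) (fderiv ℝ f u b)) (a b c : W) :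
    G (f p) (secondForm G f N p a b) (fderiv ℝ f p c) = 0 := by
  rw [secondForm, map_sub, sub_apply,
    ← koszul_pullback h hN.differentiableAt hf hNf, ← hNf.self_of_nhds,
    christoffel_spec _ _ hN.isInvertible, sub_self]

/-- The Gauss equation. -/
theorem gauss_equation [CompleteSpace V] [CompleteSpace W] {G : V → V →L[ℝ] V →L[ℝ] ℝ}
    {f : W → V} {p : W}
    {N : W → W →L[ℝ] W →L[ℝ] ℝ} (h : IsMetricAt G (f p)) (hN : IsMetricAt N p)
    (hf : ContDiffAt ℝ 3 f p)
    (hNf : ∀ᶠ u in 𝓝 p, ∀ a b, N u a b = G (f u) (fderiv ℝ f u a) (fderiv ℝ f u b))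
    (a b c d : W) :
    N p (riemann N p a b c) d =
      G (f p) (riemann G (f p) (fderiv ℝ f p a) (fderiv ℝ f p b) (fderiv ℝ f p c)) (fderiv ℝ f p d)
      + G (f p) (secondForm G f N p b c) (secondForm G f N p a d)
      - G (f p) (secondForm G f N p a c) (secondForm G f N p b d) := by
  have hf2 : ContDiffAt ℝ 2 f p := hf.of_le (by norm_num)
  have hfd : DifferentiableAt ℝ f p := hf.differentiableAt (by norm_num)
  have hdf : ContDiffAt ℝ 2 (fderiv ℝ f) p := hf.fderiv_right (by norm_num)
  have hd2 : DifferentiableAt ℝ (fderiv ℝ (fderiv ℝ f)) p :=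
    differentiableAt_fderiv_of_contDiffAt hdf
  have hd1 : DifferentiableAt ℝ (fderiv ℝ f) p := hdf.differentiableAt (by norm_num)
  -- `Q u b c` is the ambient covariant derivative of the field `df(c)` in the direction `df(b)`.
  set Q : W → W → W → V := fun u b c => fderiv ℝ (fderiv ℝ f) u b c
      + christoffel G (f u) (fderiv ℝ f u b) (fderiv ℝ f u c) with hQ
  have hcd : HasFDerivAt (fun u => christoffel G (f u)) _ p := HasFDerivAt.comp
    (g := christoffel G) p h.differentiableAt_christoffel.hasFDerivAt hfd.hasFDerivAt
  have hQd : ∀ b c, HasFDerivAt (fun u => Q u b c) _ p := fun b c =>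
    ((hd2.hasFDerivAt.clm_apply (hasFDerivAt_const b p)).clm_apply (hasFDerivAt_const c p)).add
      ((hcd.clm_apply
        (hd1.hasFDerivAt.clm_apply (hasFDerivAt_const b p))).clm_apply
        (hd1.hasFDerivAt.clm_apply (hasFDerivAt_const c p)))
  have hk : ∀ a b c d, fderiv ℝ (fun u => koszul N u b c d) p a =
      G (f p) (fderiv ℝ (fun u => Q u b c) p a + christoffel G (f p) (fderiv ℝ f p a) (Q p b c))
        (fderiv ℝ f p d) + G (f p) (Q p b c) (Q p a d) := by
    intro a b c d
    have hcont : ContinuousAt f p := hfd.continuousAt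
    have he : (fun u => koszul N u b c d) =ᶠ[𝓝 p] fun u => G (f u) (Q u b c) (fderiv ℝ f u d) := by
      filter_upwards [hNf.eventually_nhds, hcont.eventually h.eventually, hN.eventually,
        hf2.eventually (by simp)] with u h1 h2 h3 h4
      exact koszul_pullback h2 h3.differentiableAt h4 h1 b c d
    rw [he.fderiv_eq, h.fderiv_along hfd (hQd b c).differentiableAt
      (hd1.clm_apply (differentiableAt_const d)), fderiv_fderiv_apply hf2]
  have hsplit : ∀ a b, Q p a b = secondForm G f N p a b + fderiv ℝ f p (christoffel N p a b) := by
    intro a b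
    simp [secondForm, hQ]
  have hs : ∀ v w, G (f p) v w = G (f p) w v := h.symm.self_of_nhds
  -- Orthogonal splitting into normal and tangential parts. The tangential products later cancel the
  -- products of Christoffel symbols in `riemann_apply` for `N`.
  have hGQ : ∀ a b c d, G (f p) (Q p a b) (Q p c d) =
      G (f p) (secondForm G f N p a b) (secondForm G f N p c d)
        + N p (christoffel N p a b) (christoffel N p c d) := by
    intro a b c d
    have ho := secondForm_orthogonal h hN hf2 hNf
    rw [hsplit, hsplit, map_add, map_add, add_apply, add_apply, ho,
      hs (fderiv ℝ f p _), ho, hNf.self_of_nhds]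
    ring
  -- Commuting covariant derivatives along `f` yields the ambient curvature: the second and third
  -- derivatives of `f` cancel by symmetry.
  have hR : fderiv ℝ (fun u => Q u b c) p a + christoffel G (f p) (fderiv ℝ f p a) (Q p b c)
      - (fderiv ℝ (fun u => Q u a c) p b + christoffel G (f p) (fderiv ℝ f p b) (Q p a c)) =
      riemann G (f p) (fderiv ℝ f p a) (fderiv ℝ f p b) (fderiv ℝ f p c) := by
    have hC : ∀ v w z, fderiv ℝ (fun u => christoffel G u w z) (f p) v =
        fderiv ℝ (christoffel G) (f p) v w z := by
      intro v w z
      have h1 : HasFDerivAt (fun u => christoffel G u w z) _ (f p) :=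
        (h.differentiableAt_christoffel.hasFDerivAt.clm_apply
          (hasFDerivAt_const w (f p))).clm_apply (hasFDerivAt_const z (f p))
      rw [h1.fderiv]
      simp
    rw [(hQd b c).fderiv, (hQd a c).fderiv, riemann, hC, hC]
    have h3 : fderiv ℝ (fderiv ℝ (fderiv ℝ f)) p a b = fderiv ℝ (fderiv ℝ (fderiv ℝ f)) p b a :=
      snd_fderiv_symm_of_contDiffAt hdf a b
    simp only [add_apply, ContinuousLinearMap.comp_apply,
      ContinuousLinearMap.flip_apply, hQ, map_add, h3, snd_fderiv_symm_of_contDiffAt hf2 a b,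
      map_zero, zero_apply, zero_add]
    abel
  rw [hN.riemann_apply, hk, hk, hGQ, hGQ, ← hR]
  simp only [map_sub, sub_apply]
  ring

end Gauss

/-! ### Linear algebra of vectors orthogonal to a kernel. -/

section NormalVectors

variable {V E : Type*} [NormedAddCommGroup V] [NormedSpace ℝ V]
  [NormedAddCommGroup E] [InnerProductSpace ℂ E]

/-- Homogeneity. It is needed because the norms of the statement are suprema over the unit ball of
`G`, not of the norm of `V`. -/
theorem norm_apply_le_of_unit_bound {G : V →L[ℝ] V →L[ℝ] ℝ} (hpos : ∀ v, v ≠ 0 → 0 < G v v)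
    {l : V → ℝ} (hl : ∀ (c : ℝ) v, l (c • v) = |c| * l v) {n : ℝ}
    (hn : ∀ v, G v v ≤ 1 → l v ≤ n) (v : V) : l v ≤ n * √(G v v) := by
  by_cases hv : v = 0
  · subst hv
    have := hl 0 0
    simp at this
    simp [this]
  · have hs : 0 < √(G v v) := Real.sqrt_pos.2 (hpos v hv)
    have h1 := hn ((√(G v v))⁻¹ • v) (by
      simp only [map_smul, smul_apply, smul_eq_mul]
      rw [← mul_assoc, ← mul_inv, Real.mul_self_sqrt (hpos v hv).le,
        inv_mul_cancel₀ (hpos v hv).ne'])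
    rw [hl, abs_of_pos (inv_pos.2 hs), inv_mul_le_iff₀ hs] at h1
    linarith

/-- A vector `B` orthogonal to the kernel of a surjective map `L` is
`L^* (L L^*)⁻¹ L B`, hence is controlled by `L B`. -/
theorem sqrt_le_of_orthogonal_ker [FiniteDimensional ℝ E] {G : V →L[ℝ] V →L[ℝ] ℝ}
    (hpos : ∀ v, v ≠ 0 → 0 < G v v) {L : V →L[ℝ] E} {Ls : E →L[ℝ] V}
    (hL : Function.Surjective L) (hLs : ∀ e v, G (Ls e) v = (inner ℂ e (L v)).re)
    {n : ℝ} (hn : ∀ v, G v v ≤ 1 → ‖L v‖ ≤ n) {B : V} (hB : ∀ v, L v = 0 → G B v = 0) :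
    √(G B B) ≤ n * ‖(L ∘L Ls).inverse‖ * ‖L B‖ := by
  have h0 : ∀ v, G v v = 0 → v = 0 := fun v hv => by
    by_contra h
    exact (hpos v h).ne' hv
  have hinj : Function.Injective (L ∘L Ls) := by
    rw [injective_iff_map_eq_zero]
    intro e he
    have h1 : Ls e = 0 := h0 _ (by
      rw [hLs]
      have : L (Ls e) = 0 := he
      simp [this])
    obtain ⟨v, rfl⟩ := hL e
    have h2 := hLs (L v) v
    rw [h1] at h2
    simp only [map_zero, zero_apply] at h2
    have h3 : (inner ℂ (L v) (L v)).re = ‖L v‖ ^ 2 := by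
      have := inner_self_eq_norm_sq (𝕜 := ℂ) (L v)
      exact this
    rw [h3] at h2
    exact norm_eq_zero.1 (pow_eq_zero_iff (two_ne_zero) |>.1 h2.symm)
  have hT : (L ∘L Ls).IsInvertible :=
    ⟨(LinearEquiv.ofInjectiveEndo (L ∘L Ls).toLinearMap hinj).toContinuousLinearEquiv, by
      ext x; rfl⟩
  set e := (L ∘L Ls).inverse (L B) with he
  have hTe : L (Ls e) = L B := hT.self_apply_inverse (L B)
  -- `B - L^* e` lies in `ker L`, and both `B` and `L^* e` are orthogonal to `ker L`, so it is
  -- orthogonal to itself.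
  have hBe : B = Ls e := by
    rw [← sub_eq_zero]
    apply h0
    have hk : L (B - Ls e) = 0 := by rw [map_sub, hTe, sub_self]
    have : G (B - Ls e) (B - Ls e) = G B (B - Ls e) - G (Ls e) (B - Ls e) := by
      rw [map_sub G]; rfl
    rw [this, hB _ hk, hLs, hk]
    simp
  have hsq : G B B ≤ ‖e‖ * ‖L B‖ := by
    have h1 : G B B = (inner ℂ e (L B)).re := by
      rw [← hLs, ← hBe]
    rw [h1]
    exact (Complex.re_le_norm _).trans (norm_inner_le_norm _ _)
  have hle : ‖e‖ ≤ ‖(L ∘L Ls).inverse‖ * ‖L B‖ := ContinuousLinearMap.le_opNorm _ _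
  have hLB : ‖L B‖ ≤ n * √(G B B) :=
    norm_apply_le_of_unit_bound hpos (l := fun v => ‖L v‖)
      (fun c v => by simp [norm_smul]) hn B
  by_cases hB0 : B = 0
  · simp [hB0]
  have hp := hpos B hB0
  have hs : 0 < √(G B B) := Real.sqrt_pos.2 hp
  have h2 : √(G B B) * √(G B B) ≤ (n * ‖(L ∘L Ls).inverse‖ * ‖L B‖) * √(G B B) := by
    rw [Real.mul_self_sqrt hp.le]
    calc G B B ≤ ‖e‖ * ‖L B‖ := hsq
      _ ≤ (‖(L ∘L Ls).inverse‖ * ‖L B‖) * (n * √(G B B)) := by gcongr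
      _ = _ := by ring
  exact le_of_mul_le_mul_right h2 hs

/-- Positivity of `G` on `v + w` and `v - w` gives `2|G(v,w)| ≤ G(v,v) + G(w,w)`. -/
theorem abs_apply_le_of_sqrt_le {G : V →L[ℝ] V →L[ℝ] ℝ} (hs : ∀ v w, G v w = G w v)
    (hpos : ∀ v, v ≠ 0 → 0 < G v v) {M : ℝ} {v w : V} (hv : √(G v v) ≤ M) (hw : √(G w w) ≤ M) :
    |G v w| ≤ M ^ 2 := by
  have h0 : ∀ v, 0 ≤ G v v := fun v => by
    by_cases h : v = 0
    · simp [h]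
    · exact (hpos v h).le
  have hv' : G v v ≤ M ^ 2 := (Real.sqrt_le_iff.1 hv).2
  have hw' : G w w ≤ M ^ 2 := (Real.sqrt_le_iff.1 hw).2
  have h1 := h0 (v + w)
  have h2 := h0 (v - w)
  simp only [map_add, map_sub, add_apply, sub_apply, hs w v] at h1 h2
  rw [abs_le]
  constructor <;> linarith

end NormalVectors

/-! ### Zero sets of submersions and their tangent spaces. -/

section LevelSets

variable {U F W : Type*} [NormedAddCommGroup U] [NormedSpace ℝ U]
  [NormedAddCommGroup F] [NormedSpace ℝ F] [NormedAddCommGroup W] [NormedSpace ℝ W]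

/-- Local parametrization of the zero set of a submersion. -/
theorem exists_parametrization_zero_set [FiniteDimensional ℝ U] [FiniteDimensional ℝ F]
    {σ : U → F} {p : U} (hσ : ContDiffAt ℝ ∞ σ p) (h0 : σ p = 0)
    (hsurj : Function.Surjective (fderiv ℝ σ p)) :
    ∃ (m : ℕ) (ψ : EuclideanSpace ℝ (Fin m) → U), ψ 0 = p ∧ ContDiffAt ℝ ∞ ψ 0 ∧
      Function.Injective (fderiv ℝ ψ 0) ∧ Filter.map ψ (𝓝 0) = 𝓝[{u | σ u = 0}] p ∧
      ∀ v, fderiv ℝ σ p v = 0 → v ∈ Set.range (fderiv ℝ ψ 0) := by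
  have : CompleteSpace U := FiniteDimensional.complete ℝ U
  have : CompleteSpace F := FiniteDimensional.complete ℝ F
  set L := fderiv ℝ σ p
  let K := L.ker
  obtain ⟨P', hP'⟩ := LinearMap.exists_leftInverse_of_injective K.subtype (by simp)
  have hP : ∀ k : K, P' (k : U) = k := fun k => LinearMap.congr_fun hP' k
  let e : K ≃L[ℝ] EuclideanSpace ℝ (Fin (Module.finrank ℝ K)) :=
    ContinuousLinearEquiv.ofFinrankEq (by simp)
  let P : U →L[ℝ] EuclideanSpace ℝ (Fin (Module.finrank ℝ K)) :=
    e.toContinuousLinearMap ∘L P'.toContinuousLinearMap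
  have hPk : ∀ v, L v = 0 → P v = 0 → v = 0 := by
    intro v hv hPv
    have h1 : P' v = ⟨v, hv⟩ := hP ⟨v, hv⟩
    have h2 : e (P' v) = 0 := hPv
    rw [h1, e.map_eq_zero_iff] at h2
    exact congrArg Subtype.val h2
  have hPs : ∀ k, ∃ v, L v = 0 ∧ P v = k := by
    intro k
    refine ⟨e.symm k, (e.symm k).2, ?_⟩
    change e (P' (e.symm k : U)) = k
    rw [hP, e.apply_symm_apply]
  -- `L` paired with a projection onto `ker L` is bijective, so the map `Φ` below is a local
  -- diffeomorphism straightening `σ = 0` to `{0} × ker L`.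
  let A : U ≃L[ℝ] F × EuclideanSpace ℝ (Fin (Module.finrank ℝ K)) :=
    ContinuousLinearEquiv.ofBijective (L.prod P) (by
      rw [LinearMap.ker_eq_bot']
      intro v hv
      exact hPk v (congrArg Prod.fst hv) (congrArg Prod.snd hv)) (by
      rw [LinearMap.range_eq_top]
      rintro ⟨y, k⟩
      obtain ⟨v, hv⟩ := hsurj y
      obtain ⟨w, hw, hw'⟩ := hPs (k - P v)
      refine ⟨v + w, ?_⟩
      change (L (v + w), P (v + w)) = (y, k)
      rw [map_add, map_add, hw, hw', hv]
      simp)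
  have hAa : ∀ v, A v = (L v, P v) := fun v => rfl
  let Φ : U → F × EuclideanSpace ℝ (Fin (Module.finrank ℝ K)) := fun u => (σ u, P (u - p))
  have hΦ0 : Φ p = (0, 0) := by simp [Φ, h0]
  have hΦc : ContDiffAt ℝ ∞ Φ p :=
    hσ.prodMk (P.contDiff.contDiffAt.comp p (contDiffAt_id.sub contDiffAt_const))
  have hΦ : HasFDerivAt Φ (A : U →L[ℝ] _) p := by
    have h1 : HasFDerivAt (fun u => P (u - p)) P p := by
      have := HasFDerivAt.comp (g := P) (f := fun u => u - p) p P.hasFDerivAt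
        ((hasFDerivAt_id p).sub_const p)
      rwa [ContinuousLinearMap.comp_id] at this
    exact (hσ.differentiableAt (by simp)).hasFDerivAt.prodMk h1
  let H := hΦc.toOpenPartialHomeomorph Φ hΦ (by simp)
  have hpH : p ∈ H.source := hΦc.mem_toOpenPartialHomeomorph_source hΦ (by simp)
  have htH : (0, 0) ∈ H.target := hΦ0 ▸ H.map_source hpH
  have hinv : H.symm (0, 0) = p := by
    rw [← hΦ0]
    exact H.left_inv hpH
  let ψ : EuclideanSpace ℝ (Fin (Module.finrank ℝ K)) → U := fun k => H.symm (0, k)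
  have hψ0 : ψ 0 = p := hinv
  have hψc : ContDiffAt ℝ ∞ ψ 0 := by
    have h1 : ContDiffAt ℝ ∞ H.symm (0, 0) :=
      H.contDiffAt_symm htH (f₀' := A) (by rw [hinv]; exact hΦ) (by rw [hinv]; exact hΦc)
    exact h1.comp (0 : EuclideanSpace ℝ _) (contDiffAt_const.prodMk contDiffAt_id)
  have hev : ∀ᶠ k in 𝓝 (0 : EuclideanSpace ℝ (Fin (Module.finrank ℝ K))), Φ (ψ k) = (0, k) := by
    have ht : Filter.Tendsto (fun k : EuclideanSpace ℝ (Fin (Module.finrank ℝ K)) => ((0 : F), k))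
        (𝓝 0) (𝓝 (0, 0)) := by
      have : Continuous fun k : EuclideanSpace ℝ (Fin (Module.finrank ℝ K)) => ((0 : F), k) := by
        fun_prop
      exact this.tendsto 0
    filter_upwards [ht.eventually (H.open_target.mem_nhds htH)] with k hk
    exact H.right_inv hk
  -- Derivative of `Φ ∘ ψ = (0, ·)`. It gives both the injectivity of `dψ` and the inclusion of `ker
  -- L` in its range.
  have hD : ∀ k, A (fderiv ℝ ψ 0 k) = (0, k) := by
    have h1 : HasFDerivAt (fun k => Φ (ψ k)) ((A : U →L[ℝ] _) ∘L fderiv ℝ ψ 0) 0 := by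
      have hd := (hψc.differentiableAt (by simp)).hasFDerivAt
      rw [← hψ0] at hΦ
      exact hΦ.comp 0 hd
    have h2 : HasFDerivAt (fun k => Φ (ψ k))
        (ContinuousLinearMap.inr ℝ F (EuclideanSpace ℝ (Fin (Module.finrank ℝ K)))) 0 := by
      refine HasFDerivAt.congr_of_eventuallyEq (ContinuousLinearMap.hasFDerivAt _) ?_
      filter_upwards [hev] with k hk using hk
    exact fun k => congrArg (fun l => l k) (h1.unique h2)
  refine ⟨_, ψ, hψ0, hψc, ?_, ?_, ?_⟩
  · intro k k' hk
    have := hD k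
    rw [hk, hD k'] at this
    exact (congrArg Prod.snd this).symm
  · apply le_antisymm
    · refine tendsto_nhdsWithin_iff.2 ⟨hψ0 ▸ hψc.continuousAt, ?_⟩
      filter_upwards [hev] with k hk
      exact congrArg Prod.fst hk
    · intro T hT
      have hT' : ψ ⁻¹' T ∈ 𝓝 (0 : EuclideanSpace ℝ (Fin (Module.finrank ℝ K))) := hT
      have hc : Filter.Tendsto (fun u => (Φ u).2) (𝓝 p) (𝓝 0) := by
        have : Filter.Tendsto (fun u => (Φ u).2) (𝓝 p) (𝓝 (Φ p).2) :=
          continuous_snd.continuousAt.comp hΦc.continuousAt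
        rwa [hΦ0] at this
      rw [mem_nhdsWithin_iff_eventually]
      filter_upwards [hc.eventually hT', H.open_source.mem_nhds hpH] with u hu hus hu0
      have h1 : H.symm (Φ u) = u := H.left_inv hus
      have h2 : Φ u = (0, (Φ u).2) := Prod.ext hu0 rfl
      rw [h2] at h1
      rw [← h1]
      exact hu
  · intro v hv
    refine ⟨P v, A.injective ?_⟩
    rw [hD, hAa, hv]

/-- The tangent space of a parametrized submanifold contains the tangent vectors of all the maps
into this submanifold. -/
theorem range_fderiv_subset_of_parametrization {W' : Type*} [NormedAddCommGroup W']
    [NormedSpace ℝ W'] [FiniteDimensional ℝ W] [FiniteDimensional ℝ U] {S : Set U} {f : W → U}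
    {γ : W' → U} (hf : ContDiffAt ℝ 1 f 0) (hinj : Function.Injective (fderiv ℝ f 0))
    (hfS : 𝓝[S] (f 0) ≤ Filter.map f (𝓝 0)) (hγ : DifferentiableAt ℝ γ 0) (hγ0 : γ 0 = f 0)
    (hγS : Filter.map γ (𝓝 0) ≤ 𝓝[S] (f 0)) :
    Set.range (fderiv ℝ γ 0) ⊆ Set.range (fderiv ℝ f 0) := by
  have : CompleteSpace W := FiniteDimensional.complete ℝ W
  -- With `q` a left inverse of `df`, `q ∘ f` is a local diffeomorphism, and `f ∘ (q ∘ f)⁻¹ ∘ q`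
  -- fixes the points of `S` near `f 0`. Hence `γ` factors through `f` near `0`, and the chain rule
  -- concludes.
  obtain ⟨q', hq'⟩ := LinearMap.exists_leftInverse_of_injective (fderiv ℝ f 0).toLinearMap
    (LinearMap.ker_eq_bot.2 hinj)
  let q : U →L[ℝ] W := q'.toContinuousLinearMap
  have hq : q ∘L fderiv ℝ f 0 = ContinuousLinearMap.id ℝ W := by
    ext x
    exact LinearMap.congr_fun hq' x
  have hc : ContDiffAt ℝ 1 (fun w => q (f w)) 0 := q.contDiff.contDiffAt.comp 0 hf
  have hd : HasFDerivAt (fun w => q (f w)) (ContinuousLinearEquiv.refl ℝ W : W →L[ℝ] W) 0 := by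
    have := q.hasFDerivAt.comp 0 (hf.differentiableAt (by norm_num)).hasFDerivAt
    rw [hq] at this
    exact this
  let H := hc.toOpenPartialHomeomorph _ hd (by simp)
  have h0H : (0 : W) ∈ H.source := hc.mem_toOpenPartialHomeomorph_source hd (by simp)
  have hinv : H.symm (q (f 0)) = 0 := H.left_inv h0H
  have hτ : HasFDerivAt H.symm (ContinuousLinearEquiv.refl ℝ W : W →L[ℝ] W) (q (f 0)) := by
    have := H.hasFDerivAt_symm (f' := ContinuousLinearEquiv.refl ℝ W) (a := q (f 0))
      (H.map_source h0H) (by rw [hinv]; exact hd)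
    exact this
  have hret : ∀ᶠ u in 𝓝[S] (f 0), f (H.symm (q u)) = u := by
    apply hfS
    rw [Filter.mem_map]
    filter_upwards [H.open_source.mem_nhds h0H] with w hw
    have : H.symm (q (f w)) = w := H.left_inv hw
    change f (H.symm (q (f w))) = f w
    rw [this]
  have hret' : ∀ᶠ w in 𝓝 (0 : W'), f (H.symm (q (γ w))) = γ w := hγS hret
  have h1 : HasFDerivAt (fun w => q (γ w)) (q ∘L fderiv ℝ γ 0) 0 :=
    q.hasFDerivAt.comp 0 hγ.hasFDerivAt
  have h2 : HasFDerivAt (fun w => H.symm (q (γ w))) (q ∘L fderiv ℝ γ 0) 0 := by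
    rw [← hγ0] at hτ
    exact HasFDerivAt.comp (g := H.symm) (f := fun w => q (γ w)) 0 hτ h1
  have h3 : HasFDerivAt (fun w => f (H.symm (q (γ w)))) (fderiv ℝ f 0 ∘L q ∘L fderiv ℝ γ 0) 0 := by
    have hfd := (hf.differentiableAt (by norm_num)).hasFDerivAt
    have h0 : H.symm (q (γ 0)) = 0 := by rw [hγ0, hinv]
    exact HasFDerivAt.comp (g := f) (f := fun w => H.symm (q (γ w))) 0 (by rwa [h0]) h2
  have h4 := (h3.congr_of_eventuallyEq (Filter.EventuallyEq.symm hret')).fderiv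
  rintro _ ⟨w, rfl⟩
  rw [h4]
  exact ⟨_, rfl⟩

/-- Differentiating `σ ∘ f = 0` twice. -/
theorem fderiv_fderiv_of_comp_eq_zero {σ : U → F} {f : W → U} {p : W}
    (hσ : ContDiffAt ℝ 2 σ (f p)) (hf : ContDiffAt ℝ 2 f p) (h : ∀ᶠ u in 𝓝 p, σ (f u) = 0) :
    (∀ a, fderiv ℝ σ (f p) (fderiv ℝ f p a) = 0) ∧
    ∀ a b, fderiv ℝ (fderiv ℝ σ) (f p) (fderiv ℝ f p a) (fderiv ℝ f p b)
      + fderiv ℝ σ (f p) (fderiv ℝ (fderiv ℝ f) p a b) = 0 := by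
  have hfd : DifferentiableAt ℝ f p := hf.differentiableAt (by norm_num)
  -- The first-order identity is needed near `p`, not only at `p`, to be differentiated again.
  have h1 : ∀ᶠ u in 𝓝 p, ∀ b, fderiv ℝ σ (f u) (fderiv ℝ f u b) = 0 := by
    filter_upwards [h.eventually_nhds, hf.eventually (by simp),
      hfd.continuousAt.eventually (hσ.eventually (by simp))] with u hu hu1 hu2 b
    have hc := (hu2.differentiableAt (by norm_num)).hasFDerivAt.comp u
      (hu1.differentiableAt (by norm_num)).hasFDerivAt
    have h0 : HasFDerivAt (σ ∘ f) (0 : W →L[ℝ] F) u :=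
      (hasFDerivAt_const (0 : F) u).congr_of_eventuallyEq hu
    exact congrArg (fun l => l b) (hc.unique h0)
  refine ⟨h1.self_of_nhds, fun a b => ?_⟩
  have hs : HasFDerivAt (fun u => fderiv ℝ σ (f u)) _ p := HasFDerivAt.comp (g := fderiv ℝ σ) p
    (differentiableAt_fderiv_of_contDiffAt hσ).hasFDerivAt hfd.hasFDerivAt
  have h2 : HasFDerivAt (fun u => fderiv ℝ σ (f u) (fderiv ℝ f u b)) _ p :=
    hs.clm_apply ((differentiableAt_fderiv_of_contDiffAt hf).hasFDerivAt.clm_apply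
      (hasFDerivAt_const b p))
  have h3 : HasFDerivAt (fun u => fderiv ℝ σ (f u) (fderiv ℝ f u b)) (0 : W →L[ℝ] F) p :=
    (hasFDerivAt_const (0 : F) p).congr_of_eventuallyEq (by
      filter_upwards [h1] with u hu using hu b)
  have h4 := congrArg (fun l => l a) (h2.unique h3)
  simp only [add_apply, ContinuousLinearMap.comp_apply, ContinuousLinearMap.flip_apply, map_zero,
    zero_apply, zero_add] at h4
  rw [add_comm]
  exact h4

end LevelSets

/-! ### The metric of `X` in the preferred chart. -/

section MetricInChart

variable {EX : Type*} [NormedAddCommGroup EX] [NormedSpace ℂ EX]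
  {X : Type*} [TopologicalSpace X] [ChartedSpace EX X] [IsManifold 𝓘(ℝ, EX) ∞ X]
  (g : Metric EX X)

theorem pullbackMetric_congr {W : Type*} [NormedAddCommGroup W] [NormedSpace ℝ W]
    {ψ ψ' : W → X} {u : W} (h : ψ =ᶠ[𝓝 u] ψ') : pullbackMetric g ψ u = pullbackMetric g ψ' u := by
  -- The fibre carrying `g.inner` depends on the base point; with base point and derivative
  -- generalized, the equalities can be substituted.
  have key : ∀ (p q : X) (_ : p = q) (D D' : W →L[ℝ] EX), D = D' →
      (D.precomp ℝ) ∘L (g.inner p : EX →L[ℝ] EX →L[ℝ] ℝ) ∘L D =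
        (D'.precomp ℝ) ∘L (g.inner q : EX →L[ℝ] EX →L[ℝ] ℝ) ∘L D' := by
    rintro p _ rfl D _ rfl
    rfl
  exact key _ _ h.eq_of_nhds _ _ h.mfderiv_eq

/-- The model of `T_x X` is `EX` itself, identified through the preferred chart at `x`. -/
theorem chartDeriv_eq (x : X) (V : TangentSpace 𝓘(ℝ, EX) x) : chartDeriv x V = V := by
  have : chartDeriv x = ContinuousLinearMap.id ℝ (TangentSpace 𝓘(ℝ, EX) x) :=
    mfderiv_extChartAt_self (I := 𝓘(ℝ, EX)) (x := x)
  rw [this]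
  rfl

theorem mfderiv_extChartAt_symm (x : X) :
    (mfderiv 𝓘(ℝ, EX) 𝓘(ℝ, EX) (extChartAt 𝓘(ℝ, EX) x).symm (extChartAt 𝓘(ℝ, EX) x x) :
      EX →L[ℝ] EX) = ContinuousLinearMap.id ℝ EX := by
  have := mfderivWithin_range_extChartAt_symm (I := 𝓘(ℝ, EX)) (x := x)
  rw [modelWithCornersSelf_coe, Set.range_id, mfderivWithin_univ] at this
  exact this

theorem chartMetric_self (x : X) (V W : EX) :
    chartMetric g x (extChartAt 𝓘(ℝ, EX) x x) V W = g.inner x V W := by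
  have key : ∀ (p : X) (_ : p = x) (D : EX →L[ℝ] EX), D = ContinuousLinearMap.id ℝ EX →
      (g.inner p : EX →L[ℝ] EX →L[ℝ] ℝ) (D V) (D W) = g.inner x V W := by
    rintro _ rfl D rfl
    rfl
  exact key _ (extChartAt_to_inv x) _ (mfderiv_extChartAt_symm x)

theorem chartMetric_pos (x : X) (V : EX) (hV : V ≠ 0) :
    0 < chartMetric g x (extChartAt 𝓘(ℝ, EX) x x) V V := by
  rw [chartMetric_self]
  exact g.pos x V hV

theorem chartMetric_symm (x : X) (u V W : EX) : chartMetric g x u V W = chartMetric g x u W V :=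
  g.symm _ _ _

theorem isInvertible_of_pos {V : Type*} [NormedAddCommGroup V] [NormedSpace ℝ V]
    [FiniteDimensional ℝ V] {G : V →L[ℝ] V →L[ℝ] ℝ} (h : ∀ v, v ≠ 0 → 0 < G v v) :
    G.IsInvertible := by
  have hinj : Function.Injective G := by
    rw [injective_iff_map_eq_zero]
    intro v hv
    by_contra hv0
    have := h v hv0
    rw [hv] at this
    exact lt_irrefl _ this
  have hd : Module.finrank ℝ V = Module.finrank ℝ (V →L[ℝ] ℝ) := by
    rw [← (LinearMap.toContinuousLinearMap (𝕜 := ℝ) (E := V) (F' := ℝ)).finrank_eq]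
    exact Subspace.dual_finrank_eq.symm
  exact ⟨(LinearEquiv.ofInjectiveOfFinrankEq G.toLinearMap hinj hd).toContinuousLinearEquiv, by
    ext v; rfl⟩

/-- The tangent trivialization at `x` is inverted by the derivative of the inverse chart, so the
bundle coordinates of the smooth section `g` are exactly `chartMetric`. -/
theorem contDiffAt_chartMetric (x : X) :
    ContDiffAt ℝ ∞ (chartMetric g x) (extChartAt 𝓘(ℝ, EX) x x) := by
  have h1 := ((contMDiffAt_hom_bundle _).1 (g.contMDiff.contMDiffAt (x := x))).2
  have h2 : ContMDiffAt 𝓘(ℝ, EX) 𝓘(ℝ, EX) ∞ (extChartAt 𝓘(ℝ, EX) x).symm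
      (extChartAt 𝓘(ℝ, EX) x x) :=
    (contMDiffOn_extChartAt_symm x).contMDiffAt (extChartAt_target_mem_nhds x)
  have h3 := ContMDiffAt.comp_of_eq (y := x) h1 h2 (extChartAt_to_inv x)
  rw [contMDiffAt_iff_contDiffAt] at h3
  refine h3.congr_of_eventuallyEq ?_
  filter_upwards [extChartAt_target_mem_nhds (I := 𝓘(ℝ, EX)) x] with u hu
  have hs : (extChartAt 𝓘(ℝ, EX) x).symm u ∈ (chartAt EX x).source := by
    have := (extChartAt 𝓘(ℝ, EX) x).map_target hu
    rwa [extChartAt_source] at this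
  ext v w
  have hsy := TangentBundle.symmL_trivializationAt (I := 𝓘(ℝ, EX)) hs
  rw [modelWithCornersSelf_coe, Set.range_id, mfderivWithin_univ,
    (extChartAt 𝓘(ℝ, EX) x).right_inv hu] at hsy
  have h4 := inCoordinates_apply_eq₂ (𝕜 := ℝ) (F₁ := EX) (F₂ := EX) (F₃ := ℝ)
    (E₁ := fun x : X => TangentSpace 𝓘(ℝ, EX) x) (E₂ := fun x : X => TangentSpace 𝓘(ℝ, EX) x)
    (E₃ := Bundle.Trivial X ℝ) (x₀ := x) (x := (extChartAt 𝓘(ℝ, EX) x).symm u)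
    (ϕ := g.inner ((extChartAt 𝓘(ℝ, EX) x).symm u)) (v := v) (w := w)
    (by simpa using hs) (by simpa using hs) (by simp)
  refine Eq.trans ?_ h4.symm
  have hv : ∀ v : EX, (trivializationAt EX (TangentSpace 𝓘(ℝ, EX) : X → Type _) x).symm
      ((extChartAt 𝓘(ℝ, EX) x).symm u) v =
        mfderiv 𝓘(ℝ, EX) 𝓘(ℝ, EX) (extChartAt 𝓘(ℝ, EX) x).symm u v := fun v =>
    (Bundle.Trivialization.symmL_apply (R := ℝ) _ (by simpa using hs) v).symm.trans
      (congrArg (fun l : EX →L[ℝ] EX => l v) hsy)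
  rw [hv v, hv w, chartMetric, pullbackMetric_apply]
  simp

theorem isMetricAt_chartMetric [FiniteDimensional ℝ EX] (x : X) :
    IsMetricAt (chartMetric g x) (extChartAt 𝓘(ℝ, EX) x x) where
  contDiffAt := (contDiffAt_chartMetric g x).of_le ENat.LEInfty.out
  symm := Filter.Eventually.of_forall fun u v w => chartMetric_symm g x u v w
  isInvertible := isInvertible_of_pos (chartMetric_pos g x)

end MetricInChart

/-! ### Local parametrizations of subsets of `X` read in the chart. -/

section ParametrizationInChart

variable {EX : Type*} [NormedAddCommGroup EX] [NormedSpace ℂ EX]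
  {X : Type*} [TopologicalSpace X] [ChartedSpace EX X]

variable {W : Type*} [NormedAddCommGroup W]

theorem contDiffAt_extChartAt_comp [NormedSpace ℝ W] {ψ : W → X} {u : W}
    (hψ : ContMDiffAt 𝓘(ℝ, W) 𝓘(ℝ, EX) ∞ ψ u) :
    ContDiffAt ℝ ∞ (fun w => extChartAt 𝓘(ℝ, EX) (ψ u) (ψ w)) u := by
  rw [← contMDiffAt_iff_contDiffAt]
  exact (contMDiffAt_extChartAt (I := 𝓘(ℝ, EX)) (x := ψ u)).comp u hψ

theorem fderiv_extChartAt_comp [IsManifold 𝓘(ℝ, EX) ∞ X] [NormedSpace ℝ W] {ψ : W → X} {u : W}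
    (hψ : ContMDiffAt 𝓘(ℝ, W) 𝓘(ℝ, EX) ∞ ψ u) (a : W) :
    fderiv ℝ (fun w => extChartAt 𝓘(ℝ, EX) (ψ u) (ψ w)) u a =
      chartDeriv (ψ u) (mfderiv 𝓘(ℝ, W) 𝓘(ℝ, EX) ψ u a) := by
  have h1 : MDifferentiableAt 𝓘(ℝ, EX) 𝓘(ℝ, EX) (extChartAt 𝓘(ℝ, EX) (ψ u)) (ψ u) :=
    (contMDiffAt_extChartAt (n := ∞)).mdifferentiableAt (by simp)
  have h := mfderiv_comp u h1 (hψ.mdifferentiableAt (by simp))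
  rw [← mfderiv_eq_fderiv]
  exact congrArg (fun l => l a) h

theorem eventually_pullbackMetric_eq [IsManifold 𝓘(ℝ, EX) ∞ X] [NormedSpace ℝ W]
    (g : Metric EX X) {ψ : W → X} {u : W}
    (hψ : ContMDiffAt 𝓘(ℝ, W) 𝓘(ℝ, EX) ∞ ψ u) :
    ∀ᶠ w in 𝓝 u, ∀ a b, pullbackMetric g ψ w a b =
      chartMetric g (ψ u) (extChartAt 𝓘(ℝ, EX) (ψ u) (ψ w))
        (fderiv ℝ (fun w => extChartAt 𝓘(ℝ, EX) (ψ u) (ψ w)) w a)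
        (fderiv ℝ (fun w => extChartAt 𝓘(ℝ, EX) (ψ u) (ψ w)) w b) := by
  set f : W → EX := fun w => extChartAt 𝓘(ℝ, EX) (ψ u) (ψ w) with hf
  have hfc : ContDiffAt ℝ ∞ f u := contDiffAt_extChartAt_comp hψ
  have hsrc : ∀ᶠ w in 𝓝 u, ψ w ∈ (extChartAt 𝓘(ℝ, EX) (ψ u)).source :=
    hψ.continuousAt.eventually (extChartAt_source_mem_nhds (ψ u))
  filter_upwards [hsrc.eventually_nhds, (hfc.of_le (m := 1) ENat.LEInfty.out).eventually
    (by simp)] with w hw hfw a b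
  have heq : ψ =ᶠ[𝓝 w] (extChartAt 𝓘(ℝ, EX) (ψ u)).symm ∘ f := by
    filter_upwards [hw] with w' hw'
    exact ((extChartAt 𝓘(ℝ, EX) (ψ u)).left_inv hw').symm
  have ht : f w ∈ (extChartAt 𝓘(ℝ, EX) (ψ u)).target :=
    (extChartAt 𝓘(ℝ, EX) (ψ u)).map_source hw.self_of_nhds
  have hm : MDifferentiableAt 𝓘(ℝ, EX) 𝓘(ℝ, EX) (extChartAt 𝓘(ℝ, EX) (ψ u)).symm (f w) :=
    ((contMDiffOn_extChartAt_symm (n := ∞) (ψ u)).contMDiffAt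
      ((isOpen_extChartAt_target (ψ u)).mem_nhds ht)).mdifferentiableAt (by simp)
  have hc := mfderiv_comp w hm (hfw.differentiableAt (by norm_num)).mdifferentiableAt
  rw [pullbackMetric_congr g heq, pullbackMetric_apply, chartMetric, pullbackMetric_apply, hc,
    mfderiv_eq_fderiv]
  rfl

theorem map_extChartAt_comp_nhds {S : Set X} {ψ : W → X} {u : W}
    (h : Filter.map ψ (𝓝 u) = 𝓝[S] (ψ u)) :
    Filter.map (fun w => extChartAt 𝓘(ℝ, EX) (ψ u) (ψ w)) (𝓝 u) =
      𝓝[(extChartAt 𝓘(ℝ, EX) (ψ u)).symm ⁻¹' S] (extChartAt 𝓘(ℝ, EX) (ψ u) (ψ u)) := by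
  have h1 := map_extChartAt_nhdsWithin (I := 𝓘(ℝ, EX)) (s := S) (ψ u)
  rw [modelWithCornersSelf_coe, Set.range_id, Set.inter_univ, ← h, Filter.map_map] at h1
  exact h1

theorem isLocalParametrization_extChartAt_symm_comp [IsManifold 𝓘(ℝ, EX) ∞ X] {S : Set X}
    {x : X} {m : ℕ}
    {f : EuclideanSpace ℝ (Fin m) → EX} (hf : ContDiffAt ℝ ∞ f 0)
    (hf0 : f 0 = extChartAt 𝓘(ℝ, EX) x x) (hinj : Function.Injective (fderiv ℝ f 0))
    (hmap : Filter.map f (𝓝 0) =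
      𝓝[(extChartAt 𝓘(ℝ, EX) x).symm ⁻¹' S] (extChartAt 𝓘(ℝ, EX) x x)) :
    IsLocalParametrization (EX := EX) S (fun w => (extChartAt 𝓘(ℝ, EX) x).symm (f w)) := by
  have h2 : ContMDiffAt 𝓘(ℝ, EX) 𝓘(ℝ, EX) ∞ (extChartAt 𝓘(ℝ, EX) x).symm (f 0) := by
    rw [hf0]
    exact (contMDiffOn_extChartAt_symm x).contMDiffAt (extChartAt_target_mem_nhds x)
  refine ⟨h2.comp 0 hf.contMDiffAt, ?_, ?_⟩
  · have hc := mfderiv_comp 0 (h2.mdifferentiableAt (by simp))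
      (hf.differentiableAt (by simp)).mdifferentiableAt
    have hid := mfderiv_extChartAt_symm (EX := EX) x
    rw [← hf0] at hid
    intro a b hab
    apply hinj
    have hv : ∀ a, mfderiv 𝓘(ℝ, EuclideanSpace ℝ (Fin m)) 𝓘(ℝ, EX)
        (fun w => (extChartAt 𝓘(ℝ, EX) x).symm (f w)) 0 a = fderiv ℝ f 0 a := by
      intro a
      rw [← mfderiv_eq_fderiv]
      refine (congrArg (fun l => l a) hc).trans ?_
      exact congrArg (fun l : EX →L[ℝ] EX =>
        l (mfderiv 𝓘(ℝ, EuclideanSpace ℝ (Fin m)) 𝓘(ℝ, EX) f 0 a)) hid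
    exact (hv a).symm.trans (hab.trans (hv b))
  · have h1 := map_extChartAt_symm_nhdsWithin (I := 𝓘(ℝ, EX)) (s := S) x
    rw [modelWithCornersSelf_coe, Set.range_id, Set.inter_univ, ← hmap, Filter.map_map] at h1
    rw [hf0, extChartAt_to_inv x]
    exact h1

end ParametrizationInChart

/-! ### Sections, Hermitian metric and Chern connection in the trivialization. -/

theorem contDiffAt_secLoc {EX : Type*} [NormedAddCommGroup EX] [NormedSpace ℂ EX]
    {X : Type*} [TopologicalSpace X] [ChartedSpace EX X]
    {F : Type*} [NormedAddCommGroup F] [NormedSpace ℂ F]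
    {E : X → Type*} [TopologicalSpace (Bundle.TotalSpace F E)]
    [∀ x, NormedAddCommGroup (E x)] [FiberBundle F E] [IsManifold 𝓘(ℂ, EX) ω X]
    {s : ∀ x, E x} {x : X}
    (hs : ContMDiffAt 𝓘(ℂ, EX) (𝓘(ℂ, EX).prod 𝓘(ℂ, F)) ω
      (fun y => Bundle.TotalSpace.mk' F y (s y)) x) :
    ContDiffAt ℝ ∞ (secLoc F s x) (extChartAt 𝓘(ℝ, EX) x x) := by
  have h1 := (Bundle.contMDiffAt_section x).1 hs
  have h2 : ContMDiffAt 𝓘(ℂ, EX) 𝓘(ℂ, EX) ω (extChartAt 𝓘(ℂ, EX) x).symm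
      (extChartAt 𝓘(ℂ, EX) x x) :=
    (contMDiffOn_extChartAt_symm x).contMDiffAt (extChartAt_target_mem_nhds x)
  have h3 := ContMDiffAt.comp_of_eq (y := x) h1 h2 (extChartAt_to_inv x)
  rw [contMDiffAt_iff_contDiffAt] at h3
  exact (h3.restrict_scalars ℝ).of_le le_top

section BundleInChart

variable {EX : Type*} [NormedAddCommGroup EX] [NormedSpace ℂ EX]
  {X : Type*} [TopologicalSpace X] [ChartedSpace EX X]
  {F : Type*} [NormedAddCommGroup F] [NormedSpace ℂ F]
  {E : X → Type*} [TopologicalSpace (Bundle.TotalSpace F E)]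
  [∀ x, NormedAddCommGroup (E x)] [∀ x, InnerProductSpace ℂ (E x)]
  [FiberBundle F E] [VectorBundle ℂ F E]

theorem contDiffAt_gramLoc [IsManifold 𝓘(ℝ, EX) ∞ X] (hE : IsSmoothHermitian EX F E) (x : X) :
    ContDiffAt ℝ ∞ (gramLoc F E x) (extChartAt 𝓘(ℝ, EX) x x) := by
  have h1 := (hE x).contMDiffAt ((trivializationAt F E x).open_baseSet.mem_nhds
    (FiberBundle.mem_baseSet_trivializationAt' x))
  have h2 : ContMDiffAt 𝓘(ℝ, EX) 𝓘(ℝ, EX) ∞ (extChartAt 𝓘(ℝ, EX) x).symm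
      (extChartAt 𝓘(ℝ, EX) x x) :=
    (contMDiffOn_extChartAt_symm x).contMDiffAt (extChartAt_target_mem_nhds x)
  have h3 := ContMDiffAt.comp_of_eq (y := x) h1 h2 (extChartAt_to_inv x)
  rwa [contMDiffAt_iff_contDiffAt] at h3

theorem gram_apply (x y : X) (v w : F) : gram F E x y v w =
    inner ℂ ((trivializationAt F E x).symmL ℂ y w) ((trivializationAt F E x).symmL ℂ y v) := rfl

variable (F E) in
/-- The fibre at `x` in the preferred trivialization. -/
noncomputable def fiberEquiv (x : X) : F ≃L[ℂ] E x :=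
  ((trivializationAt F E x).continuousLinearEquivAt ℂ x
    (FiberBundle.mem_baseSet_trivializationAt' x)).symm

theorem symmL_eq_fiberEquiv (x : X) (v : F) :
    (trivializationAt F E x).symmL ℂ x v = fiberEquiv F E x v :=
  Bundle.Trivialization.symmL_apply _ (FiberBundle.mem_baseSet_trivializationAt' x) v

theorem isInvertible_gram [FiniteDimensional ℂ F] (x : X) : (gram F E x x).IsInvertible := by
  have : FiniteDimensional ℂ (E x) := (fiberEquiv F E x).toLinearEquiv.finiteDimensional
  have : CompleteSpace F := FiniteDimensional.complete ℂ F
  have : CompleteSpace (E x) := FiniteDimensional.complete ℂ (E x)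
  have hinj : (gram F E x x).ker = ⊥ := by
    rw [LinearMap.ker_eq_bot']
    intro v hv
    have h1 : gram F E x x v v = 0 := congrArg (fun l : F →L⋆[ℂ] ℂ => l v) hv
    rw [gram_apply, inner_self_eq_zero, symmL_eq_fiberEquiv] at h1
    exact (fiberEquiv F E x).map_eq_zero_iff.1 h1
  have hsurj : (gram F E x x).range = ⊤ := by
    rw [LinearMap.range_eq_top]
    intro l
    -- The Riesz theorem applies to linear forms, so the conjugate-linear `l` is first conjugated.
    let l' : E x →L[ℂ] ℂ :=
      ((starL ℂ : ℂ ≃L⋆[ℂ] ℂ) : ℂ →L⋆[ℂ] ℂ).comp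
        (l.comp (fiberEquiv F E x).symm.toContinuousLinearMap)
    refine ⟨(fiberEquiv F E x).symm ((InnerProductSpace.toDual ℂ (E x)).symm l'), ?_⟩
    ext w
    change gram F E x x _ w = l w
    rw [gram_apply, symmL_eq_fiberEquiv, symmL_eq_fiberEquiv, ContinuousLinearEquiv.apply_symm_apply,
      ← inner_conj_symm, InnerProductSpace.toDual_symm_apply]
    change star (star (l ((fiberEquiv F E x).symm (fiberEquiv F E x w)))) = l w
    rw [star_star, ContinuousLinearEquiv.symm_apply_apply]
  exact ⟨ContinuousLinearEquiv.ofBijective _ hinj hsurj, by ext; rfl⟩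

theorem isInvertible_gramLoc [FiniteDimensional ℂ F] (x : X) :
    (gramLoc F E x (extChartAt 𝓘(ℝ, EX) x x)).IsInvertible := by
  rw [gramLoc, extChartAt_to_inv]
  exact isInvertible_gram x

theorem differentiableAt_chernForm [IsManifold 𝓘(ℝ, EX) ∞ X] [FiniteDimensional ℂ F]
    (hE : IsSmoothHermitian EX F E) (x : X) :
    DifferentiableAt ℝ (chernForm F E x) (extChartAt 𝓘(ℝ, EX) x x) := by
  have : CompleteSpace F := FiniteDimensional.complete ℂ F
  have hg := contDiffAt_gramLoc hE x
  have hD : DifferentiableAt ℝ (fderiv ℝ (gramLoc F E x)) (extChartAt 𝓘(ℝ, EX) x x) :=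
    differentiableAt_fderiv_of_contDiffAt (hg.of_le ENat.LEInfty.out)
  have hdel : DifferentiableAt ℝ (delGram F E x) (extChartAt 𝓘(ℝ, EX) x x) := by
    have h1 := (hD.clm_comp (differentiableAt_const
      ((Complex.I • ContinuousLinearMap.id ℂ EX).restrictScalars ℝ))).const_smul Complex.I
    exact (hD.sub h1).const_smul (1 / 2 : ℝ)
  obtain ⟨e, he⟩ := isInvertible_gramLoc (EX := EX) (F := F) (E := E) x
  have hinv : DifferentiableAt ℝ (fun u => (gramLoc F E x u).inverse)
      (extChartAt 𝓘(ℝ, EX) x x) := by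
    have h1 : DifferentiableAt ℂ ContinuousLinearMap.inverse (e : F →L[ℂ] F →L⋆[ℂ] ℂ) :=
      (contDiffAt_map_inverse (n := 1) e).differentiableAt (by norm_num)
    have h2 := h1.restrictScalars ℝ
    rw [he] at h2
    exact h2.comp _ (hg.differentiableAt (by simp))
  let T : ((F →L⋆[ℂ] ℂ) →L[ℂ] F) →L[ℝ] (F →L[ℂ] F →L⋆[ℂ] ℂ) →L[ℝ] F →L[ℂ] F :=
    (ContinuousLinearMap.restrictScalarsL ℂ (F →L[ℂ] F →L⋆[ℂ] ℂ) (F →L[ℂ] F) ℝ ℝ) ∘L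
      (ContinuousLinearMap.compL ℂ F (F →L⋆[ℂ] ℂ) F).restrictScalars ℝ
  have hT : DifferentiableAt ℝ (fun u => T (gramLoc F E x u).inverse)
      (extChartAt 𝓘(ℝ, EX) x x) := T.differentiableAt.comp _ hinv
  exact hT.clm_comp hdel

theorem differentiableAt_covLoc {s : ∀ x, E x} {x : X} {u : EX}
    (hs : ContDiffAt ℝ 2 (secLoc F s x) u) (hA : DifferentiableAt ℝ (chernForm F E x) u) :
    DifferentiableAt ℝ (covLoc F s x) u := by
  let T : F →L[ℝ] (F →L[ℂ] F) →L[ℝ] F :=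
    (ContinuousLinearMap.restrictScalarsL ℂ (F →L[ℂ] F) F ℝ ℝ) ∘L
      (ContinuousLinearMap.apply ℂ F).restrictScalars ℝ
  have hT : DifferentiableAt ℝ (fun u => T (secLoc F s x u)) u :=
    T.differentiableAt.comp u (hs.differentiableAt (by norm_num))
  exact (differentiableAt_fderiv_of_contDiffAt hs).add (hT.clm_comp hA)

/-- At a zero of `s`, the covariant derivative is the derivative in coordinates. -/
theorem covLoc_of_eq_zero {s : ∀ x, E x} {x : X} {u : EX} (h0 : secLoc F s x u = 0) (V : EX) :
    covLoc F s x u V = fderiv ℝ (secLoc F s x) u V := by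
  rw [covLoc_apply, h0, map_zero, add_zero]

/-- In the derivative of `A(W)s`, the term `(D_V A)(W)s` vanishes with `s`; only `A(W) D_V s`
remains. -/
theorem fderiv_covLoc_of_eq_zero {s : ∀ x, E x} {x : X} {u : EX}
    (hs : ContDiffAt ℝ 2 (secLoc F s x) u) (hA : DifferentiableAt ℝ (chernForm F E x) u)
    (h0 : secLoc F s x u = 0) (V W : EX) :
    fderiv ℝ (covLoc F s x) u V W = fderiv ℝ (fderiv ℝ (secLoc F s x)) u V W
      + chernForm F E x u W (fderiv ℝ (secLoc F s x) u V) := by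
  have h1 : HasFDerivAt (fun u => covLoc F s x u W) _ u :=
    (differentiableAt_covLoc hs hA).hasFDerivAt.clm_apply (hasFDerivAt_const W u)
  have h2 : HasFDerivAt (fun u => (ContinuousLinearMap.restrictScalarsL ℂ F F ℝ ℝ)
      (chernForm F E x u W)) _ u :=
    (ContinuousLinearMap.restrictScalarsL ℂ F F ℝ ℝ).hasFDerivAt.comp u
      (hA.hasFDerivAt.clm_apply (hasFDerivAt_const W u))
  have h3 : HasFDerivAt (fun u => covLoc F s x u W) _ u :=
    ((differentiableAt_fderiv_of_contDiffAt hs).hasFDerivAt.clm_apply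
      (hasFDerivAt_const W u)).add
      (h2.clm_apply (hs.differentiableAt (by norm_num)).hasFDerivAt)
  have h4 := congrArg (fun l => l V) (h1.unique h3)
  simpa [h0] using h4

/-- The second covariant derivative at a zero of `s`, on the kernel of the first one. -/
theorem hessLoc_of_eq_zero [IsManifold 𝓘(ℝ, EX) ∞ X] (g : Metric EX X) {s : ∀ x, E x} {x : X}
    {u : EX} (hs : ContDiffAt ℝ 2 (secLoc F s x) u)
    (hA : DifferentiableAt ℝ (chernForm F E x) u) (h0 : secLoc F s x u = 0) {V W : EX}
    (hV : fderiv ℝ (secLoc F s x) u V = 0) (hW : fderiv ℝ (secLoc F s x) u W = 0) :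
    hessLoc F g s x u V W = fderiv ℝ (fderiv ℝ (secLoc F s x)) u V W
      - fderiv ℝ (secLoc F s x) u (christoffel (chartMetric g x) u V W) := by
  rw [hessLoc_apply, fderiv_covLoc_of_eq_zero hs hA h0, covLoc_of_eq_zero h0, covLoc_of_eq_zero h0,
    hV, hW, map_zero, map_zero, add_zero, add_zero]

theorem eventually_secLoc_eq_zero_iff (s : ∀ x, E x) (x : X) :
    ∀ᶠ u in 𝓝 (extChartAt 𝓘(ℝ, EX) x x),
      (secLoc F s x u = 0 ↔ s ((extChartAt 𝓘(ℝ, EX) x).symm u) = 0) := by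
  have hc : ContinuousAt (extChartAt 𝓘(ℝ, EX) x).symm (extChartAt 𝓘(ℝ, EX) x x) :=
    continuousAt_extChartAt_symm x
  have hb : (trivializationAt F E x).baseSet ∈
      𝓝 ((extChartAt 𝓘(ℝ, EX) x).symm (extChartAt 𝓘(ℝ, EX) x x)) := by
    rw [extChartAt_to_inv]
    exact (trivializationAt F E x).open_baseSet.mem_nhds
      (FiberBundle.mem_baseSet_trivializationAt' x)
  filter_upwards [hc.eventually hb] with u hu
  have h1 : secLoc F s x u = (trivializationAt F E x).continuousLinearEquivAt ℂ _ hu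
      (s ((extChartAt 𝓘(ℝ, EX) x).symm u)) := by
    rw [Bundle.Trivialization.continuousLinearEquivAt_apply]
    rfl
  rw [h1]
  exact ContinuousLinearEquiv.map_eq_zero_iff _

theorem nhdsWithin_zero_set (s : ∀ x, E x) (x : X) :
    𝓝[(extChartAt 𝓘(ℝ, EX) x).symm ⁻¹' {y | s y = 0}] (extChartAt 𝓘(ℝ, EX) x x) =
      𝓝[{u | secLoc F s x u = 0}] (extChartAt 𝓘(ℝ, EX) x x) := by
  apply nhdsWithin_eq_iff_eventuallyEq.2
  filter_upwards [eventually_secLoc_eq_zero_iff (F := F) s x] with u hu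
  exact propext hu.symm

end BundleInChart

/-- Halving moves the closed unit ball of `G` into the open one. The bound makes the suprema
defining `normNabla` and `normNabla2` genuine, as `sSup` of an unbounded set is `0`. -/
theorem exists_norm_le_of_isVonNBounded {V : Type*} [NormedAddCommGroup V] [NormedSpace ℝ V]
    {G : V →L[ℝ] V →L[ℝ] ℝ} (h : Bornology.IsVonNBounded ℝ {v | G v v < 1}) :
    ∃ R : ℝ, ∀ v, G v v ≤ 1 → ‖v‖ ≤ R := by
  rw [NormedSpace.isVonNBounded_iff, isBounded_iff_forall_norm_le] at h
  obtain ⟨R, hR⟩ := h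
  refine ⟨2 * R, fun v hv => ?_⟩
  have h2 : ‖(1 / 2 : ℝ) • v‖ ≤ R := hR _ (by
    change G ((1 / 2 : ℝ) • v) ((1 / 2 : ℝ) • v) < 1
    simp only [map_smul, smul_apply, smul_eq_mul]
    linarith)
  rw [norm_smul] at h2
  norm_num at h2
  linarith

/-! ### The zero locus of a section and its curvature. -/

section ZeroLocus

variable {EX : Type*} [NormedAddCommGroup EX] [NormedSpace ℂ EX]
  {X : Type*} [TopologicalSpace X] [ChartedSpace EX X]
  {F : Type*} [NormedAddCommGroup F] [NormedSpace ℂ F]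
  {E : X → Type*} [TopologicalSpace (Bundle.TotalSpace F E)]
  [∀ x, NormedAddCommGroup (E x)] [∀ x, InnerProductSpace ℂ (E x)]
  [FiberBundle F E] [VectorBundle ℂ F E]

theorem norm_nabla_le [IsManifold 𝓘(ℝ, EX) ∞ X] (g : Metric EX X) (s : ∀ x, E x)
    (x : X) (V : TangentSpace 𝓘(ℝ, EX) x)
    (hV : g.inner x V V ≤ 1) : ‖nabla F s x V‖ ≤ normNabla F g s x := by
  obtain ⟨R, hR⟩ := exists_norm_le_of_isVonNBounded (V := EX) (G := g.inner x) (g.isVonNBounded x)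
  let L : EX →L[ℝ] E x := nabla F s x
  refine le_csSup ⟨‖L‖ * R, ?_⟩ ⟨V, hV, rfl⟩
  rintro _ ⟨V, hV, rfl⟩
  exact L.le_opNorm_of_le (hR V hV)

theorem norm_nabla2_le [IsManifold 𝓘(ℝ, EX) ∞ X] (g : Metric EX X) (s : ∀ x, E x)
    (x : X) (V W : TangentSpace 𝓘(ℝ, EX) x)
    (hV : g.inner x V V ≤ 1) (hW : g.inner x W W ≤ 1) :
    ‖nabla2 F g s x V W‖ ≤ normNabla2 F g s x := by
  obtain ⟨R, hR⟩ := exists_norm_le_of_isVonNBounded (V := EX) (G := g.inner x) (g.isVonNBounded x)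
  set A := (trivializationAt F E x).symmL ℂ x
  set H := hessLoc F g s x (extChartAt 𝓘(ℝ, EX) x x)
  refine le_csSup ⟨‖A‖ * (‖H‖ * R * R), ?_⟩ ⟨V, W, hV, hW, rfl⟩
  rintro _ ⟨V, W, hV, hW, rfl⟩
  rw [nabla2, chartDeriv_eq, chartDeriv_eq]
  exact A.le_opNorm_of_le ((H V).le_of_opNorm_le_of_le (H.le_opNorm_of_le (hR V hV)) (hR W hW))

theorem normNabla_nonneg [IsManifold 𝓘(ℝ, EX) ∞ X] (g : Metric EX X) (s : ∀ x, E x)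
    (x : X) : 0 ≤ normNabla F g s x :=
  (norm_nonneg _).trans (norm_nabla_le g s x 0 (by simp))

theorem normNabla2_nonneg [IsManifold 𝓘(ℝ, EX) ∞ X] (g : Metric EX X) (s : ∀ x, E x)
    (x : X) : 0 ≤ normNabla2 F g s x :=
  (norm_nonneg _).trans (norm_nabla2_le g s x 0 0 (by simp) (by simp))

theorem secLoc_eq_zero {s : ∀ x, E x} {x : X} (h0 : s x = 0) :
    secLoc F s x (extChartAt 𝓘(ℝ, EX) x x) = 0 := by
  rw [(eventually_secLoc_eq_zero_iff (EX := EX) (F := F) s x).self_of_nhds, extChartAt_to_inv, h0]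

theorem nabla_of_eq_zero [IsManifold 𝓘(ℝ, EX) ∞ X] {s : ∀ x, E x} {x : X}
    (h0 : s x = 0) (V : EX) :
    nabla (EX := EX) F s x V =
      fiberEquiv F E x (fderiv ℝ (secLoc F s x) (extChartAt 𝓘(ℝ, EX) x x) V) := by
  rw [← symmL_eq_fiberEquiv, ← covLoc_of_eq_zero (secLoc_eq_zero h0)]
  exact congrArg (fun V => (trivializationAt F E x).symmL ℂ x
    (covLoc F s x (extChartAt 𝓘(ℝ, EX) x x) V)) (chartDeriv_eq x V)

theorem surjective_fderiv_secLoc [IsManifold 𝓘(ℝ, EX) ∞ X] {s : ∀ x, E x} {x : X} (h0 : s x = 0)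
    (hsurj : Function.Surjective (nabla (EX := EX) F s x)) :
    Function.Surjective (fderiv ℝ (secLoc F s x) (extChartAt 𝓘(ℝ, EX) x x)) := by
  intro y
  obtain ⟨V, hV⟩ := hsurj (fiberEquiv F E x y)
  exact ⟨V, (fiberEquiv F E x).injective ((nabla_of_eq_zero (EX := EX) h0 V).symm.trans hV)⟩

/-- The zero set of a section is a submanifold near its nondegenerate zeros. -/
theorem exists_isLocalParametrization_zero_set [IsManifold 𝓘(ℝ, EX) ∞ X]
    [FiniteDimensional ℂ EX] [FiniteDimensional ℂ F] {s : ∀ x, E x} {x : X}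
    (hs : ContDiffAt ℝ ∞ (secLoc F s x) (extChartAt 𝓘(ℝ, EX) x x)) (h0 : s x = 0)
    (hsurj : Function.Surjective (nabla (EX := EX) F s x)) :
    ∃ (m : ℕ) (ψ : EuclideanSpace ℝ (Fin m) → X),
      IsLocalParametrization (EX := EX) {y | s y = 0} ψ ∧ ψ 0 = x := by
  obtain ⟨m, f, hf0, hf, hinj, hmap, -⟩ := exists_parametrization_zero_set hs (secLoc_eq_zero h0)
    (surjective_fderiv_secLoc h0 hsurj)
  refine ⟨m, fun w => (extChartAt 𝓘(ℝ, EX) x).symm (f w),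
    isLocalParametrization_extChartAt_symm_comp hf hf0 hinj ?_, ?_⟩
  · rw [hmap, nhdsWithin_zero_set (F := F)]
  · change (extChartAt 𝓘(ℝ, EX) x).symm (f 0) = x
    rw [hf0, extChartAt_to_inv]

/-- The curvature estimate for the zero set of a section, in a local parametrization. -/
theorem abs_secCurv_sub_le [IsManifold 𝓘(ℝ, EX) ∞ X] (g : Metric EX X)
    [FiniteDimensional ℂ EX] [FiniteDimensional ℂ F] {s : ∀ x, E x} {m : ℕ}
    {ψ : EuclideanSpace ℝ (Fin m) → X} (hψ : IsLocalParametrization (EX := EX) {y | s y = 0} ψ)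
    (hE : IsSmoothHermitian EX F E)
    (hs : ContDiffAt ℝ ∞ (secLoc F s (ψ 0)) (extChartAt 𝓘(ℝ, EX) (ψ 0) (ψ 0))) (h0 : s (ψ 0) = 0)
    (hsurj : Function.Surjective (nabla (EX := EX) F s (ψ 0)))
    (a b : EuclideanSpace ℝ (Fin m))
    (haa : g.inner (ψ 0) (mfderiv 𝓘(ℝ, EuclideanSpace ℝ (Fin m)) 𝓘(ℝ, EX) ψ 0 a)
      (mfderiv 𝓘(ℝ, EuclideanSpace ℝ (Fin m)) 𝓘(ℝ, EX) ψ 0 a) = 1)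
    (hbb : g.inner (ψ 0) (mfderiv 𝓘(ℝ, EuclideanSpace ℝ (Fin m)) 𝓘(ℝ, EX) ψ 0 b)
      (mfderiv 𝓘(ℝ, EuclideanSpace ℝ (Fin m)) 𝓘(ℝ, EX) ψ 0 b) = 1)
    (hab : g.inner (ψ 0) (mfderiv 𝓘(ℝ, EuclideanSpace ℝ (Fin m)) 𝓘(ℝ, EX) ψ 0 a)
      (mfderiv 𝓘(ℝ, EuclideanSpace ℝ (Fin m)) 𝓘(ℝ, EX) ψ 0 b) = 0) :
    |secCurv (pullbackMetric g ψ) 0 a b - sectionalCurvature g (ψ 0)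
        (mfderiv 𝓘(ℝ, EuclideanSpace ℝ (Fin m)) 𝓘(ℝ, EX) ψ 0 a)
        (mfderiv 𝓘(ℝ, EuclideanSpace ℝ (Fin m)) 𝓘(ℝ, EX) ψ 0 b)| ≤
      2 * (normNabla F g s (ψ 0) * ‖(nabla F s (ψ 0) ∘L nablaStar F g s (ψ 0)).inverse‖ *
        normNabla2 F g s (ψ 0)) ^ 2 := by
  have : CompleteSpace EX := FiniteDimensional.complete ℂ EX
  set x := ψ 0 with hx
  set f : EuclideanSpace ℝ (Fin m) → EX := fun w => extChartAt 𝓘(ℝ, EX) x (ψ w) with hf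
  set G := chartMetric g x with hGdef
  set N := pullbackMetric g ψ with hNdef
  have hf0 : f 0 = extChartAt 𝓘(ℝ, EX) x x := rfl
  have hfc : ContDiffAt ℝ ∞ f 0 := contDiffAt_extChartAt_comp hψ.smooth
  have hf2 : ContDiffAt ℝ 2 f 0 := hfc.of_le ENat.LEInfty.out
  have hf3 : ContDiffAt ℝ 3 f 0 := hfc.of_le ENat.LEInfty.out
  have hdf : ∀ c, fderiv ℝ f 0 c = mfderiv 𝓘(ℝ, EuclideanSpace ℝ (Fin m)) 𝓘(ℝ, EX) ψ 0 c :=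
    fun c => (fderiv_extChartAt_comp hψ.smooth c).trans (chartDeriv_eq x _)
  have hinj : Function.Injective (fderiv ℝ f 0) := by
    intro c d hcd
    rw [hdf, hdf] at hcd
    exact hψ.immersion hcd
  have hG : IsMetricAt G (f 0) := isMetricAt_chartMetric g x
  have hGx : ∀ v w : EX, G (f 0) v w = g.inner x v w := chartMetric_self g x
  have hGpos : ∀ v : EX, v ≠ 0 → 0 < G (f 0) v v := chartMetric_pos g x
  have hNf : ∀ᶠ w in 𝓝 0, ∀ a b, N w a b = G (f w) (fderiv ℝ f w a) (fderiv ℝ f w b) :=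
    eventually_pullbackMetric_eq g hψ.smooth
  have hN0 : ∀ a b, N 0 a b = G (f 0) (fderiv ℝ f 0 a) (fderiv ℝ f 0 b) := hNf.self_of_nhds
  have hN : IsMetricAt N 0 := hG.of_pullback hf3 (isInvertible_of_pos fun c hc => by
    rw [hN0]
    exact hGpos _ fun h => hc (hinj (h.trans (map_zero _).symm))) hNf
  set σ := secLoc (EX := EX) F s x with hσ
  have hσ2 : ContDiffAt ℝ 2 σ (f 0) := hs.of_le ENat.LEInfty.out
  have hσ0 : σ (f 0) = 0 := secLoc_eq_zero h0
  have hA : DifferentiableAt ℝ (chernForm F E x) (f 0) := differentiableAt_chernForm hE x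
  have hmap : Filter.map f (𝓝 0) = 𝓝[{u | σ u = 0}] (f 0) :=
    (map_extChartAt_comp_nhds hψ.map_nhds).trans (nhdsWithin_zero_set s x)
  have hσf : ∀ᶠ w in 𝓝 0, σ (f w) = 0 := by
    have h1 : {u | σ u = 0} ∈ Filter.map f (𝓝 0) := by
      rw [hmap]
      exact self_mem_nhdsWithin
    exact h1
  obtain ⟨hd1, hd2⟩ := fderiv_fderiv_of_comp_eq_zero hσ2 hf2 hσf
  -- `ψ` is an arbitrary parametrization of the zero set, so its tangent space is compared with that
  -- of the one given by the inverse function theorem, which contains the kernel.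
  have hker : ∀ v, fderiv ℝ σ (f 0) v = 0 → v ∈ Set.range (fderiv ℝ f 0) := by
    obtain ⟨m', γ, hγ0, hγ, -, hγmap, hγker⟩ := exists_parametrization_zero_set hs hσ0
      (surjective_fderiv_secLoc h0 hsurj)
    intro v hv
    exact range_fderiv_subset_of_parametrization (hfc.of_le ENat.LEInfty.out) hinj hmap.ge
      (hγ.differentiableAt (by simp)) hγ0 hγmap.le (hγker v hv)
  set B := secondForm G f N 0 with hB
  have hnab : ∀ v : EX, nabla (EX := EX) F s x v = fiberEquiv F E x (fderiv ℝ σ (f 0) v) :=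
    nabla_of_eq_zero h0
  -- `dσ` kills the tangential term of `B` and sends `D²f(c,d)` to `-D²σ(df c, df d)`; the
  -- Christoffel term is the one in the Hessian.
  have hLB : ∀ c d, nabla (EX := EX) F s x (B c d) = - nabla2 F g s x
      (mfderiv 𝓘(ℝ, EuclideanSpace ℝ (Fin m)) 𝓘(ℝ, EX) ψ 0 c)
      (mfderiv 𝓘(ℝ, EuclideanSpace ℝ (Fin m)) 𝓘(ℝ, EX) ψ 0 d) := by
    intro c d
    rw [hnab, nabla2, symmL_eq_fiberEquiv, ← map_neg, ← fderiv_extChartAt_comp hψ.smooth,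
      ← fderiv_extChartAt_comp hψ.smooth]
    refine congrArg _ ?_
    refine Eq.trans ?_ (congrArg Neg.neg
      (hessLoc_of_eq_zero g hσ2 hA hσ0 (hd1 c) (hd1 d)).symm)
    rw [hB, secondForm, map_sub, map_add, hd1, eq_neg_of_add_eq_zero_right (hd2 c d)]
    abel
  have hsqrt : ∀ c d, g.inner x (mfderiv 𝓘(ℝ, EuclideanSpace ℝ (Fin m)) 𝓘(ℝ, EX) ψ 0 c)
      (mfderiv 𝓘(ℝ, EuclideanSpace ℝ (Fin m)) 𝓘(ℝ, EX) ψ 0 c) = 1 →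
      g.inner x (mfderiv 𝓘(ℝ, EuclideanSpace ℝ (Fin m)) 𝓘(ℝ, EX) ψ 0 d)
      (mfderiv 𝓘(ℝ, EuclideanSpace ℝ (Fin m)) 𝓘(ℝ, EX) ψ 0 d) = 1 →
      √(G (f 0) (B c d) (B c d)) ≤ normNabla F g s x *
        ‖(nabla F s x ∘L nablaStar F g s x).inverse‖ * normNabla2 F g s x := by
    intro c d hc hd
    have hfd : FiniteDimensional ℂ (E x) := (fiberEquiv F E x).toLinearEquiv.finiteDimensional
    have hginv : (g.inner x : EX →L[ℝ] EX →L[ℝ] ℝ).IsInvertible :=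
      isInvertible_of_pos (V := EX) (G := g.inner x) fun v hv => g.pos x v hv
    have h1 := sqrt_le_of_orthogonal_ker (V := EX) (E := E x) hGpos (L := nabla F s x)
      (Ls := nablaStar F g s x) hsurj
      (fun e v => (hGx _ v).trans (nablaStar_spec F g s x hginv e v))
      (n := normNabla F g s x)
      (fun v hv => norm_nabla_le g s x v ((hGx v v).symm.trans_le hv)) (B := B c d)
      (fun v hv => by
        obtain ⟨w, rfl⟩ := hker v ((fiberEquiv F E x).map_eq_zero_iff.1 ((hnab v).symm.trans hv))
        exact secondForm_orthogonal hG hN hf2 hNf c d w)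
    refine h1.trans (mul_le_mul_of_nonneg_left ?_
      (mul_nonneg (normNabla_nonneg g s x) (norm_nonneg _)))
    refine (congrArg norm (hLB c d)).trans_le ?_
    rw [norm_neg]
    exact norm_nabla2_le g s x _ _ hc.le hd.le
  have hgauss := gauss_equation hG hN hf3 hNf a b b a
  -- For an orthonormal pair the denominator of `secCurv` equals `1`.
  have hK : secCurv N 0 a b = N 0 (riemann N 0 a b b) a := by
    rw [secCurv, hN0 a a, hN0 b b, hN0 a b, hGx, hGx, hGx, hdf, hdf, haa, hbb, hab]
    norm_num
  have hKX : sectionalCurvature g x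
        (mfderiv 𝓘(ℝ, EuclideanSpace ℝ (Fin m)) 𝓘(ℝ, EX) ψ 0 a)
        (mfderiv 𝓘(ℝ, EuclideanSpace ℝ (Fin m)) 𝓘(ℝ, EX) ψ 0 b) =
      G (f 0) (riemann G (f 0) (fderiv ℝ f 0 a) (fderiv ℝ f 0 b) (fderiv ℝ f 0 b))
        (fderiv ℝ f 0 a) := by
    rw [sectionalCurvature, ← fderiv_extChartAt_comp hψ.smooth,
      ← fderiv_extChartAt_comp hψ.smooth]
    change secCurv G (f 0) (fderiv ℝ f 0 a) (fderiv ℝ f 0 b) = _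
    rw [secCurv, hGx (fderiv ℝ f 0 a) (fderiv ℝ f 0 a), hGx (fderiv ℝ f 0 b) (fderiv ℝ f 0 b),
      hGx (fderiv ℝ f 0 a) (fderiv ℝ f 0 b), hdf a, hdf b, haa, hbb, hab]
    norm_num
  rw [hK, hKX, hgauss]
  have hGs : ∀ v w, G (f 0) v w = G (f 0) w v := chartMetric_symm g x _
  -- The two products of `B` in the Gauss equation are each at most `M²`, whence the factor `2`.
  have e1 := abs_apply_le_of_sqrt_le hGs hGpos (hsqrt b b hbb hbb) (hsqrt a a haa haa)
  have e2 := abs_apply_le_of_sqrt_le hGs hGpos (hsqrt a b haa hbb) (hsqrt b a hbb haa)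
  rw [abs_le] at e1 e2 ⊢
  constructor <;> linarith [e1.1, e1.2, e2.1, e2.2]

end ZeroLocus

end KahlerCurv

theorem proposition3p2
    {EX : Type*} [NormedAddCommGroup EX] [NormedSpace ℂ EX] [FiniteDimensional ℂ EX]
    {X : Type*} [TopologicalSpace X] [T2Space X] [CompactSpace X] [ChartedSpace EX X]
    [IsManifold 𝓘(ℂ, EX) ω X]
    (g : KahlerCurv.Metric EX X) (hg : KahlerCurv.IsKahler g)
    {F : Type*} [NormedAddCommGroup F] [NormedSpace ℂ F] [FiniteDimensional ℂ F]
    {E : X → Type*} [TopologicalSpace (Bundle.TotalSpace F E)]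
    [∀ x, NormedAddCommGroup (E x)] [∀ x, InnerProductSpace ℂ (E x)]
    [FiberBundle F E] [VectorBundle ℂ F E] [ContMDiffVectorBundle ω F E 𝓘(ℂ, EX)]
    (hE : KahlerCurv.IsSmoothHermitian EX F E) :
    ∃ C : ℝ, 0 < C ∧ ∀ s : Cₛ^ω⟮𝓘(ℂ, EX); F, E⟯,
      KahlerCurv.IsTransverse EX F s → ∀ x : X, s x = 0 →
        (∃ (m : ℕ) (ψ : EuclideanSpace ℝ (Fin m) → X),
          KahlerCurv.IsLocalParametrization (EX := EX) {y | s y = 0} ψ ∧ ψ 0 = x) ∧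
        ∀ V W : TangentSpace 𝓘(ℝ, EX) x,
          g.inner x V V = 1 → g.inner x W W = 1 → g.inner x V W = 0 →
          ∀ K : ℝ, KahlerCurv.HasSectionalCurvature g {y | s y = 0} x V W K →
            |K - KahlerCurv.sectionalCurvature g x V W| ≤
              C * ‖(KahlerCurv.nabla F s x ∘L KahlerCurv.nablaStar F g s x).inverse‖ ^ 2 *
                (KahlerCurv.normNabla2 F g s x + KahlerCurv.normNabla F g s x) ^ 2 *
                KahlerCurv.normNabla F g s x ^ 2 := by
  refine ⟨2, two_pos, fun s hs x h0 => ?_⟩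
  have hsm : ContDiffAt ℝ ∞ (KahlerCurv.secLoc (E := E) F s x) (extChartAt 𝓘(ℝ, EX) x x) :=
    KahlerCurv.contDiffAt_secLoc s.contMDiff.contMDiffAt
  refine ⟨KahlerCurv.exists_isLocalParametrization_zero_set hsm h0 (hs x h0), ?_⟩
  intro V W hV hW hVW K hK
  cases hK with
  | intro ψ hψ a b =>
    refine (KahlerCurv.abs_secCurv_sub_le g hψ hE hsm h0 (hs _ h0) a b hV hW hVW).trans ?_
    have h1 := KahlerCurv.normNabla_nonneg (F := F) g s (ψ 0)
    have h2 := KahlerCurv.normNabla2_nonneg (F := F) g s (ψ 0)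
    -- It remains to enlarge `‖∇²s‖` to `‖∇²s‖ + ‖∇s‖`.
    calc _ = 2 * ‖(KahlerCurv.nabla F s (ψ 0) ∘L KahlerCurv.nablaStar F g s (ψ 0)).inverse‖ ^ 2 *
          KahlerCurv.normNabla2 F g s (ψ 0) ^ 2 * KahlerCurv.normNabla F g s (ψ 0) ^ 2 := by ring
      _ ≤ _ := by
        gcongr
        linarith
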